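/- **Cell complexes.** A *cell complex* (cc) is a finite vertex set $S$ with a family $K$ of non-empty subsets of $S$ (*cells*) and a rank function $\mathrm{rk}_K:K\to\mathbb N$ whose rank-$0$ cells are exactly the singletons of $S$ (identified with the vertices; $K^{[r]}$ is the set of $r$-cells), such that: (i) $x\subsetneq y$ implies $\mathrm{rk}(x)<\mathrm{rk}(y)$; (ii) $K\cup\{\emptyset\}$ is closed under $\cap$; (iii) if $x\subsetneq y$ then $x$ is a face of a cell contained in $y$; (iv) if $x\subset y$ and $\mathrm{rk}(y)=\mathrm{rk}(x)+2$, exactly two cells are both co-faces of $x$ and faces of $y$. Here a face (co-face) of $x$ is a cell contained in (containing) $x$ of rank one less (more). $\mathrm{Rk}(K)$ is the maximal rank, $J\le K$ means $J\subset K$ and $\mathrm{rk}_J=\mathrm{rk}_K|_J$, and $K\cap A=\{x\in K: x\subset A\}$. Let $R=\mathrm{Rk}(K)$. $K$ is *pure* if all maximal cells have rank $R$; $\partial K$ consists of the cells contained in an $(R-1)$-cell with exactly one co-face; $K$ is *graph-based* if edges ($1$-cells) have at most two vertices; *non-singular* if it is graph-based, pure and each $(R-1)$-cell has at most two co-faces;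 *closed* if moreover $\partial K=\emptyset$; *connected* if it is graph-based with connected graph of edges; *cell-connected* if $K\cap x$ is connected for every cell $x$; *local* if connected and cell-connected; *non-pinching* if for $N=K$ and $N=\partial K$ and every $x\in N$ the graph with vertices the maximal-rank cells of $N$ containing $x$, two being joined if they are the co-faces of a non-boundary cell of $N$ of rank $\mathrm{Rk}(N)-1$ containing $x$, is connected. $\mathsf C^R$ is the set of non-empty non-singular non-pinching local cc of rank $R$, $\mathsf C=\bigcup_R\mathsf C^R$; $\mathsf B^R$ is the set of closed non-pinching cell-connected cc of rank $R$, together with the empty cc, and $\mathsf B=\bigcup_R\mathsf B^R$. **Maps.** A poset homomorphism $\phi:J\to K$ is a *cc-homomorphism* if each $y\in\phi(J)$ has a preimage of rank $\mathrm{rk}_K(y)$; an isomorphism is a bijective one whose inverse is a cc-homomorphism. A surjective poset homomorphism $\rho:J\to K$ is a *reduction* if (r1) every vertex of $K$ has one preimage; (r2) for non-maximal $x$, $\rho$ maps the meet of the set of co-faces of $x$ to the meet of its image; (r3) if $\rho(x)\subset y$ there is $x'\supset x$ with $\mathrm{rk}(x')=\mathrm{rk}(y)$, $\rho(x')=y$;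 (r4) if $\mathrm{rk}(x)=\mathrm{rk}(\rho(x))-1$, exactly two co-faces of $x$ are mapped to $\rho(x)$; (r5) if $\mathrm{rk}(x)=\mathrm{rk}(\rho(x))$, each co-face of $\rho(x)$ is the image of exactly one co-face of $x$. It is a *collapse* $\pi$ if (c1) every maximal cell of $K$ has one preimage; (c2) $\pi(x)$ is the join of the images of the faces of $x$ if $\mathrm{rk}(x)\ge1$; (c3) if $y\subset\pi(x)$ there is $x'\subset x$ with $\mathrm{rk}(x')=\mathrm{rk}(y)$, $\pi(x')=y$; (c4) if $\mathrm{rk}(x)=\mathrm{rk}(\pi(x))+1$, exactly two faces of $x$ are mapped to $\pi(x)$; (c5) if $\mathrm{rk}(x)=\mathrm{rk}(\pi(x))$, each face of $\pi(x)$ is the image of exactly one face of $x$. A *relative cc* is a pair $(K,J)$ of cc with $J\le K$. A *relative reduction* $(K,J)\to(H,L)$ is a cc-homomorphism $K\to H$ that is a reduction, maps $J$ onto $L$, and restricts to a poset isomorphism $K\setminus J\to H\setminus L$. Maps $j:J\to I$ and $l:L\to I$: $j$ is *compatible* with $l$ if each $w\in I$ has exactly one preimage under $j$ or exactly one under $l$,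 $j$ preserves existing joins of two cells, and $l$ preserves non-empty intersections of two cells. Maps $j:I\to J$, $l:I\to L$ are *reflective* if whenever $j(w)\vee j(w')$ and $l(w)\vee l(w')$ exist, $w\vee w'$ exists, $j(w\vee w')=j(w)\vee j(w')$ and $l(w\vee w')=l(w)\vee l(w')$. **Uniformity.** Let $(K,J)$ be a relative cc with $K$ graph-based. The collar $K_J$ is the set of cells of $K$ having both a vertex in $J$ and a vertex not in $J$; for $x\in K_J$, $\mathcal E_J^x$ is the set of edges of $K_J$ in $x$ and $x_J$ the set of vertices of $J$ on these edges. The midsection is $M_J^K=\{\mathcal E_J^x: x\in K_J\}$ with rank $\mathrm{rk}_K(x)-1$, the transition is $J(K)=\{x_J:x\in K_J\}$ with rank $\mathrm{Rk}(J\cap x)$, and $\pi_J^K:M_J^K\to J(K)$ is $\mathcal E_J^x\mapsto x_J$. Let $K_J^-(x)$ (resp. $K_J^-[a]$) be the set of minimal elements of $\{y\in K_J: x\subset y\}$ (resp. $\{y\in K_J:y_J=a\}$). $(K,J)$ is *non-degenerate* if no cell of $K\setminus J$ has all its vertices in $J$; *uniform* if it is non-degenerate, $J\cap x$ is pure for $x\in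 K_J$, for each $x\in J$ all cells of $K_J^-(x)$ have the same rank, $J\cap x\subset J\cap y\Leftrightarrow x_J\subset y_J$ for all $x,y\in K_J$, and $J(K)\in\mathsf B$. Then $\rho_J^K:J\to J(K)$ maps $x$ to the cell $c\in J(K)$ with $K_J^-[c]=K_J^-(x)$ and whose rank is one less than the rank of the cells in $K_J^-(x)$. **Connecting.** Let $R\ge1$, $K,H\in\mathsf C^R$, and let $J,L\in\mathsf B^{R-1}$ be connected components of $\partial K$, $\partial H$ with $(K,J)$, $(H,L)$ uniform. Let $I\in\mathsf B^{R-1}$ and $K',H'\in\mathsf C^R$. Relative reductions $\rho_J:(K',I)\to(K,J)$ and $\rho_L:(H',I)\to(H,L)$ *connect $K$ and $H$ through $I$* if in $$M_J^K\xrightarrow{\pi_J^K}J(K)\xleftarrow{\rho_J^K\circ\rho_J}I\xrightarrow{\rho_L^H\circ\rho_L}L(H)\xleftarrow{\pi_L^H}M_L^H$$ all five complexes are local and in $\mathsf B$, the outer maps are collapses, the inner maps are reductions, $\rho_J^K\circ\rho_J$ is compatible with $\pi_J^K$, $\rho_L^H\circ\rho_L$ is compatible with $\pi_L^H$, and $\rho_J^K\circ\rho_J$,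 $\rho_L^H\circ\rho_L$ are reflective. **Statement.** (1) If $\rho_J,\rho_L$ connect $K$ and $H$ through $I$ and $K'\cap H'=I$, then $K'\cup H'$ with rank function $\mathrm{rk}_{K'}+\mathrm{rk}_{H'}-\mathrm{rk}_I$ (each term extended by $0$) is an element of $\mathsf C^R$, and up to cc-isomorphism it is uniquely determined by $K$, $H$ and the reductions $\rho_J|_I:I\to J$, $\rho_L|_I:I\to L$. (2) A *cobordism* $(K-J)$ consists of $K\in\mathsf C$ and $J\le\partial K$ with $J\in\mathsf B^{\mathrm{Rk}(K)-1}$ such that $(K,J)$ is non-degenerate and, for every connected component $J_0$ of $J$, $J_0\cap x$ is connected for all $x\in K_{J_0}$ and $M_{J_0}^K$ is cell-connected. Let $(K-J)$ and $(H-L)$ be cobordisms with $\partial H=J\sqcup L$ and $K\cap H=J$, where $J$ is a connected component of $\partial K$ and of $\partial H$, $(K,J)$ and $(H,J)$ are uniform, and the identity maps $(K,J)\to(K,J)$ and $(H,J)\to(H,J)$ connect $K$ and $H$ through $J$. Then, with $K\cup H$ ranked by $\mathrm{rk}_K+\mathrm{rk}_H-\mathrm{rk}_J$, $(K\cup H-L)$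 is a cobordism. -/

import Mathlib

/-- A family of subsets ("cells") of a vertex type together with a rank function on the cells.
The rank function is extended by zero to sets which are not cells. No axiom is imposed here;
`CellData.IsCC` singles out the (combinatorial) cell complexes. -/
@[ext]
structure CellData (V : Type*) where
  cells : Set (Set V)
  rk : Set V → ℕ
  rk_off : ∀ x, x ∉ cells → rk x = 0

namespace CellData

variable {V W A B : Type*}

/-- The family `C` with the rank function obtained by restricting `r` to `C`. -/
noncomputable def ofCells (C : Set (Set V)) (r : Set V → ℕ) : CellData V where
  cells := C
  rk := C.indicator r
  rk_off := fun _ hx => Set.indicator_of_notMem hx r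

/-! ### Cell complexes -/

/-- The vertices of `K`; a vertex `v` is identified with the cell `{v}`. -/
def verts (K : CellData V) : Set V := {v | {v} ∈ K.cells}

/-- The faces of `x`. -/
def face (K : CellData V) (x : Set V) : Set (Set V) :=
  {y | y ∈ K.cells ∧ y ⊆ x ∧ K.rk y + 1 = K.rk x}

/-- The co-faces of `x`. -/
def coface (K : CellData V) (x : Set V) : Set (Set V) :=
  {y | y ∈ K.cells ∧ x ⊆ y ∧ K.rk y = K.rk x + 1}

/-- `K` is a (combinatorial) cell complex, abbreviated cc. -/
structure IsCC (K : CellData V) : Prop where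
  finite : K.verts.Finite
  nonempty : ∀ x ∈ K.cells, x.Nonempty
  subset_verts : ∀ x ∈ K.cells, x ⊆ K.verts
  rk_eq_zero_iff : ∀ x ∈ K.cells, K.rk x = 0 ↔ ∃ v, x = {v}
  rk_lt : ∀ x ∈ K.cells, ∀ y ∈ K.cells, x ⊂ y → K.rk x < K.rk y
  inter_mem : ∀ x ∈ K.cells, ∀ y ∈ K.cells, (x ∩ y).Nonempty → x ∩ y ∈ K.cells
  no_gap : ∀ x ∈ K.cells, ∀ y ∈ K.cells, x ⊂ y → ∃ z ∈ K.cells, z ⊆ y ∧ x ∈ K.face z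
  diamond : ∀ x ∈ K.cells, ∀ y ∈ K.cells, x ⊆ y → K.rk x + 2 = K.rk y →
    (K.coface x ∩ K.face y).ncard = 2

/-- The rank (dimension) of `K`: the least `R` such that all cells have rank at most `R`. -/
noncomputable def Rk (K : CellData V) : ℕ := sInf {R | ∀ x ∈ K.cells, K.rk x ≤ R}

/-- The restriction `K ∩ S` of `K` to a set `S` of vertices. -/
noncomputable def restrict (K : CellData V) (S : Set V) : CellData V :=
  ofCells {x | x ∈ K.cells ∧ x ⊆ S} K.rk

/-- `J ≤ K`: `J` is a sub-cc of `K` (for `J`, `K` cc). -/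
def IsSub (J K : CellData V) : Prop :=
  J.cells ⊆ K.cells ∧ ∀ x ∈ J.cells, J.rk x = K.rk x

/-- Every maximal cell has rank `Rk K`. -/
def IsPure (K : CellData V) : Prop :=
  ∀ x ∈ K.cells, (∀ y ∈ K.cells, x ⊆ y → y = x) → K.rk x = K.Rk

/-- The boundary `∂K`: all cells contained in a sub-maximal cell having exactly one co-face. -/
noncomputable def boundary (K : CellData V) : CellData V :=
  ofCells {x | x ∈ K.cells ∧
    ∃ y ∈ K.cells, K.rk y + 1 = K.Rk ∧ (K.coface y).ncard = 1 ∧ x ⊆ y} K.rk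

/-- Every edge has at most two vertices. -/
def IsGraphBased (K : CellData V) : Prop :=
  ∀ e ∈ K.cells, K.rk e = 1 → e.ncard ≤ 2

/-- Graph-based, pure and non-branching. -/
def IsNonSingular (K : CellData V) : Prop :=
  K.IsGraphBased ∧ K.IsPure ∧ ∀ y ∈ K.cells, K.rk y + 1 = K.Rk → (K.coface y).ncard ≤ 2

/-- Non-singular with empty boundary. -/
def IsClosedCC (K : CellData V) : Prop :=
  K.IsNonSingular ∧ K.boundary.cells = ∅

/-- The graph (1-skeleton) of a graph-based cc. -/
def edgeGraph (K : CellData V) : SimpleGraph V where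
  Adj v w := v ≠ w ∧ {v, w} ∈ K.cells ∧ K.rk {v, w} = 1
  symm := ⟨fun v w h => ⟨h.1.symm, (Set.pair_comm v w) ▸ h.2⟩⟩
  loopless := ⟨fun _ h => h.1 rfl⟩

/-- Graph-based, and any two vertices are joined by a path of edges. -/
def IsConnected (K : CellData V) : Prop :=
  K.IsGraphBased ∧ ∀ v ∈ K.verts, ∀ w ∈ K.verts, K.edgeGraph.Reachable v w

/-- Graph-based, and every cell is connected. -/
def IsCellConnected (K : CellData V) : Prop :=
  K.IsGraphBased ∧ ∀ x ∈ K.cells, (K.restrict x).IsConnected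

/-- Local cc: a connected and cell-connected cc. -/
def IsLocal (K : CellData V) : Prop :=
  K.IsCC ∧ K.IsConnected ∧ K.IsCellConnected

/-- `J` is a connected component of `K`. -/
def IsComponent (J K : CellData V) : Prop :=
  ∃ v ∈ K.verts, J = K.restrict {w | K.edgeGraph.Reachable v w}

/-- The dual set of `x`: the cells of rank `Rk K` containing `x`. -/
def dual (K : CellData V) (x : Set V) : Set (Set V) :=
  {z | z ∈ K.cells ∧ K.rk z = K.Rk ∧ x ⊆ z}

/-- The dual graph: its vertices are the cells of rank `Rk K`, its edges are the dual sets of the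
sub-maximal cells not in the boundary. -/
def dualGraph (K : CellData V) : SimpleGraph (Set V) where
  Adj z z' := z ≠ z' ∧
    ∃ y ∈ K.cells, y ∉ K.boundary.cells ∧ K.rk y + 1 = K.Rk ∧ K.dual y = {z, z'}
  symm := ⟨fun z z' h => ⟨h.1.symm, (Set.pair_comm z z') ▸ h.2⟩⟩
  loopless := ⟨fun _ h => h.1 rfl⟩

/-- There is no `K`-pinch: around each cell the dual graph is connected. -/
def NoPinch (K : CellData V) : Prop :=
  ∀ x ∈ K.cells, (K.dualGraph.induce (K.dual x)).Preconnected

/-- No `K`-pinch and no `∂K`-pinch. -/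
def IsNonPinching (K : CellData V) : Prop :=
  K.NoPinch ∧ K.boundary.NoPinch

/-- The class `C^R`: (non-empty) non-singular non-pinching local cc of rank `R`. -/
structure InC (K : CellData V) (R : ℕ) : Prop where
  isLocal : K.IsLocal
  cells_nonempty : K.cells.Nonempty
  nonSingular : K.IsNonSingular
  nonPinching : K.IsNonPinching
  rank_eq : K.Rk = R

/-- The class `B`: closed non-pinching cell-connected cc. The empty cc belongs to it. -/
structure InB (J : CellData V) : Prop where
  isCC : J.IsCC
  closed : J.IsClosedCC
  nonPinching : J.IsNonPinching
  cellConnected : J.IsCellConnected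

/-- The class `B^R`: the elements of `B` of rank `R`, and the empty cc. -/
def InBRank (J : CellData V) (R : ℕ) : Prop :=
  J.InB ∧ (J.cells.Nonempty → J.Rk = R)

/-! ### Relative cell complexes, collars, midsections -/

/-- `(K, J)` is a relative cc. -/
structure IsRelCC (K J : CellData V) : Prop where
  left : K.IsCC
  right : J.IsCC
  sub : J.IsSub K

/-- `(K, J)` is non-degenerate. -/
def NonDegenerate (K J : CellData V) : Prop :=
  ∀ x ∈ K.cells, x ∉ J.cells → ¬ x ⊆ J.verts

/-- The collar `K_J`. -/
def collar (K J : CellData V) : Set (Set V) :=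
  {x | x ∈ K.cells ∧ (x ∩ J.verts).Nonempty ∧ x ∩ J.verts ≠ x}

/-- The set of edges of the collar `K_J` contained in `x`. -/
def collarEdges (K J : CellData V) (x : Set V) : Set (Set V) :=
  {e | e ∈ K.collar J ∧ K.rk e = 1 ∧ e ⊆ x}

/-- The midsection `M_J^K`. Its vertices are the edges of the collar, its cells are the sets
`collarEdges K J x`, `x ∈ K_J`, and the rank of `collarEdges K J x` is `K.rk x - 1`
(for local `K` the cell `x` is determined by `collarEdges K J x`). -/
noncomputable def midsection (K J : CellData V) : CellData (Set V) :=
  ofCells {m | ∃ x ∈ K.collar J, m = K.collarEdges J x}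
    (fun m => sInf {r | ∃ x ∈ K.collar J, K.collarEdges J x = m ∧ r + 1 = K.rk x})

/-- `(K, J)` is a local relative cc. -/
structure IsLocalRel (K J : CellData V) : Prop where
  relCC : IsRelCC K J
  nonDegenerate : NonDegenerate K J
  isLocal : K.IsLocal
  inter_connected : ∀ J₀ : CellData V, J₀.IsComponent J →
    ∀ x ∈ K.collar J₀, (J₀.restrict x).IsConnected
  midsection_cellConnected : ∀ J₀ : CellData V, J₀.IsComponent J →
    (K.midsection J₀).IsCellConnected

/-- `(K - J)` is a cobordism. (If `Rk K = 0` then `∂K`, hence `J`, is empty.) -/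
structure IsCob (K J : CellData V) : Prop where
  inC : K.InC K.Rk
  sub : J.IsSub K.boundary
  inB : J.InBRank (K.Rk - 1)
  nonDegenerate : NonDegenerate K J
  isLocalRel : IsLocalRel K J

/-! ### Homomorphisms, reductions and collapses

Maps between cell complexes are represented by functions on all sets of vertices, of which only the
values on cells matter. -/

/-- `φ` is a poset homomorphism from the cells of `J` to the cells of `K`. -/
structure IsPosetHom (J : CellData V) (K : CellData W) (φ : Set V → Set W) : Prop where
  mapsTo : Set.MapsTo φ J.cells K.cells
  mono : ∀ x ∈ J.cells, ∀ y ∈ J.cells, x ⊆ y → φ x ⊆ φ y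

/-- `φ` is a cc-homomorphism. -/
structure IsCCHom (J : CellData V) (K : CellData W) (φ : Set V → Set W) : Prop
    extends IsPosetHom J K φ where
  rank_lift : ∀ y ∈ φ '' J.cells, ∃ x ∈ J.cells, J.rk x = K.rk y ∧ φ x = y

/-- `J` and `K` are isomorphic cc. -/
def Isomorphic (J : CellData V) (K : CellData W) : Prop :=
  ∃ (φ : Set V → Set W) (ψ : Set W → Set V), IsCCHom J K φ ∧ IsCCHom K J ψ ∧
    (∀ x ∈ J.cells, ψ (φ x) = x) ∧ (∀ y ∈ K.cells, φ (ψ y) = y)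

/-- `g` is the greatest lower bound of `S` in the poset of cells of `K`. -/
def IsMeet (K : CellData V) (S : Set (Set V)) (g : Set V) : Prop :=
  g ∈ K.cells ∧ (∀ s ∈ S, g ⊆ s) ∧ ∀ a ∈ K.cells, (∀ s ∈ S, a ⊆ s) → a ⊆ g

/-- `g` is the least upper bound of `S` in the poset of cells of `K`. -/
def IsJoin (K : CellData V) (S : Set (Set V)) (g : Set V) : Prop :=
  g ∈ K.cells ∧ (∀ s ∈ S, s ⊆ g) ∧ ∀ a ∈ K.cells, (∀ s ∈ S, s ⊆ a) → g ⊆ a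

/-- The fibre of a map defined on the cells of `J`. -/
def fibre (J : CellData V) (φ : Set V → Set W) (y : Set W) : Set (Set V) :=
  {x | x ∈ J.cells ∧ φ x = y}

/-- `ρ` is a reduction from `J` to `K`. In `r2`, the greatest lower bound of the set of co-faces of
`x` exists if that set is non-empty; if `x` is maximal there is no condition. -/
structure IsReduction (J : CellData V) (K : CellData W) (ρ : Set V → Set W) : Prop
    extends IsPosetHom J K ρ where
  surj : ∀ y ∈ K.cells, ∃ x ∈ J.cells, ρ x = y
  r1 : ∀ v ∈ K.cells, K.rk v = 0 → (J.fibre ρ v).ncard = 1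
  r2 : ∀ x ∈ J.cells, (J.coface x).Nonempty →
    ∀ g, J.IsMeet (J.coface x) g → K.IsMeet (ρ '' J.coface x) (ρ g)
  r3 : ∀ x ∈ J.cells, ∀ y ∈ K.cells, ρ x ⊆ y →
    ∃ x' ∈ J.cells, x ⊆ x' ∧ J.rk x' = K.rk y ∧ ρ x' = y
  r4 : ∀ x ∈ J.cells, J.rk x + 1 = K.rk (ρ x) → (J.coface x ∩ J.fibre ρ (ρ x)).ncard = 2
  r5 : ∀ x ∈ J.cells, J.rk x = K.rk (ρ x) →
    ∀ y ∈ K.coface (ρ x), (J.coface x ∩ J.fibre ρ y).ncard = 1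

/-- `π` is a collapse from `J` to `K`. -/
structure IsCollapse (J : CellData V) (K : CellData W) (π : Set V → Set W) : Prop
    extends IsPosetHom J K π where
  surj : ∀ y ∈ K.cells, ∃ x ∈ J.cells, π x = y
  c1 : ∀ z ∈ K.cells, (∀ y ∈ K.cells, z ⊆ y → y = z) → (J.fibre π z).ncard = 1
  c2 : ∀ x ∈ J.cells, 1 ≤ J.rk x → K.IsJoin (π '' J.face x) (π x)
  c3 : ∀ x ∈ J.cells, ∀ y ∈ K.cells, y ⊆ π x →
    ∃ x' ∈ J.cells, x' ⊆ x ∧ J.rk x' = K.rk y ∧ π x' = y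
  c4 : ∀ x ∈ J.cells, J.rk x = K.rk (π x) + 1 → (J.face x ∩ J.fibre π (π x)).ncard = 2
  c5 : ∀ x ∈ J.cells, J.rk x = K.rk (π x) →
    ∀ y ∈ K.face (π x), (J.face x ∩ J.fibre π y).ncard = 1

/-- `φ : (K, J) → (H, L)` is a relative reduction: a reduction `K → H` which is a cc-homomorphism
with `φ(J) = L` and restricts to a poset isomorphism `K ∖ J → H ∖ L`. -/
structure IsRelReduction (K J : CellData V) (H L : CellData W) (φ : Set V → Set W) : Prop where
  relCC_source : IsRelCC K J
  relCC_target : IsRelCC H L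
  ccHom : IsCCHom K H φ
  image_eq : φ '' J.cells = L.cells
  bijOn : Set.BijOn φ (K.cells \ J.cells) (H.cells \ L.cells)
  subset_iff : ∀ x ∈ K.cells \ J.cells, ∀ y ∈ K.cells \ J.cells, x ⊆ y ↔ φ x ⊆ φ y
  reduction : IsReduction K H φ

/-! ### Transitions and uniformity -/

/-- For a set `m` of edges, the set of the vertices of `J` cut out by the edges in `m`. On the
midsection this is the map `π_J^K`, sending `collarEdges K J x` to the reduced cell `x_J`. -/
def piMap (J : CellData V) (m : Set (Set V)) : Set V :=
  {v | ∃ e ∈ m, e ∩ J.verts = {v}}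

/-- The reduced cell `x_J` of a cell `x` of the collar `K_J`. -/
def reducedCell (K J : CellData V) (x : Set V) : Set V :=
  J.piMap (K.collarEdges J x)

/-- The transition `J(K)`, the rank of a reduced cell `x_J` being `Rk (J ∩ x)` (for uniform `(K, J)`
this only depends on `x_J`). -/
noncomputable def transition (K J : CellData V) : CellData V :=
  ofCells {a | ∃ x ∈ K.collar J, a = K.reducedCell J x}
    (fun a => sInf {r | ∃ x ∈ K.collar J, K.reducedCell J x = a ∧ r = (J.restrict x).Rk})

/-- The minimal elements `K_J^-(S)` of the set of cells of the collar containing `S`. -/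
def minAbove (K J : CellData V) (S : Set V) : Set (Set V) :=
  {y | Minimal (fun z => z ∈ K.collar J ∧ S ⊆ z) y}

/-- The minimal elements `K_J^-[a]` of the set of cells of the collar with reduced cell `a`. -/
def minOver (K J : CellData V) (a : Set V) : Set (Set V) :=
  {y | Minimal (fun z => z ∈ K.collar J ∧ K.reducedCell J z = a) y}

/-- `(K, J)` is a pure relative cc. -/
def IsPureRel (K J : CellData V) : Prop :=
  (∀ x ∈ K.collar J, (J.restrict x).IsPure) ∧
    ∀ x ∈ J.cells, ∀ y ∈ K.minAbove J x, ∀ y' ∈ K.minAbove J x, K.rk y = K.rk y'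

/-- The relative rank of `x ∈ J` in `K`: one less than the common rank of the elements of
`K_J^-(x)`. -/
noncomputable def relRank (K J : CellData V) (x : Set V) : ℕ :=
  sInf {r | ∃ y ∈ K.minAbove J x, r + 1 = K.rk y}

/-- The relative cc `(K, J)` is uniform. -/
structure IsUniform (K J : CellData V) : Prop where
  relCC : IsRelCC K J
  nonDegenerate : NonDegenerate K J
  pureRel : IsPureRel K J
  uniformity : ∀ x ∈ K.collar J, ∀ y ∈ K.collar J,
    (J.restrict x).cells ⊆ (J.restrict y).cells ↔ K.reducedCell J x ⊆ K.reducedCell J y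
  transition_inB : (K.transition J).InB

/-- The map `ρ_J^K : J → J(K)`: it sends `x ∈ J` to the unique cell `c` of `J(K)` with
`K_J^-[c] = K_J^-(x)` and with rank the relative rank of `x` (the union below is over this single
cell; if there is none the value is `∅`, which is not a cell). -/
def rhoMap (K J : CellData V) (x : Set V) : Set V :=
  ⋃₀ {c | c ∈ (K.transition J).cells ∧ K.minOver J c = K.minAbove J x ∧
    (K.transition J).rk c = K.relRank J x}

/-! ### Compatible and reflective homomorphisms, connecting sequences -/

/-- `j : J → I` is compatible with `l : L → I`. -/
structure Compatible (J : CellData V) (L : CellData A) (I : CellData W)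
    (j : Set V → Set W) (l : Set A → Set W) : Prop where
  fibre_eq_one : ∀ w ∈ I.cells, (J.fibre j w).ncard = 1 ∨ (L.fibre l w).ncard = 1
  join : ∀ x ∈ J.cells, ∀ x' ∈ J.cells, ∀ u, J.IsJoin {x, x'} u → I.IsJoin {j x, j x'} (j u)
  inter : ∀ y ∈ L.cells, ∀ y' ∈ L.cells, (y ∩ y').Nonempty → l (y ∩ y') = l y ∩ l y'

/-- `j : I → J` and `l : I → L` are reflective. -/
def Reflective (I : CellData V) (J : CellData W) (L : CellData A)
    (j : Set V → Set W) (l : Set V → Set A) : Prop :=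
  ∀ w ∈ I.cells, ∀ w' ∈ I.cells, ∀ a b, J.IsJoin {j w, j w'} a → L.IsJoin {l w, l w'} b →
    ∃ u, I.IsJoin {w, w'} u ∧ j u = a ∧ l u = b

/-- `M ⊢ J ≻ I ≺ L ⊣ M'` with the maps `πJ : M → J`, `ρJ : I → J`, `ρL : I → L`, `πL : M' → L` is a
connecting sequence. -/
structure IsConnectingSeq {V₁ V₂ V₃ V₄ V₅ : Type*} (M : CellData V₁) (J : CellData V₂)
    (I : CellData V₃) (L : CellData V₄) (M' : CellData V₅)
    (πJ : Set V₁ → Set V₂) (ρJ : Set V₃ → Set V₂) (ρL : Set V₃ → Set V₄)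
    (πL : Set V₅ → Set V₄) : Prop where
  inB : M.InB ∧ J.InB ∧ I.InB ∧ L.InB ∧ M'.InB
  isLocal : M.IsLocal ∧ J.IsLocal ∧ I.IsLocal ∧ L.IsLocal ∧ M'.IsLocal
  collapse_left : IsCollapse M J πJ
  reduction_left : IsReduction I J ρJ
  reduction_right : IsReduction I L ρL
  collapse_right : IsCollapse M' L πL
  compatible_left : Compatible I M J ρJ πJ
  compatible_right : Compatible I M' L ρL πL
  reflective : Reflective I J L ρJ ρL

/-- The relative reductions `ρJ : (K', I) → (K, J)` and `ρL : (H', I) → (H, L)` connect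
`K, H ∈ C^(R+1)` through `I`, where `J`, `L` are connected components of `∂K`, `∂H`. -/
structure Connects (R : ℕ) (K J : CellData A) (H L : CellData B) (I K' H' : CellData V)
    (ρJ : Set V → Set A) (ρL : Set V → Set B) : Prop where
  inC_left : K.InC (R + 1)
  inC_right : H.InC (R + 1)
  inB_left : J.InBRank R
  inB_right : L.InBRank R
  component_left : J.IsComponent K.boundary
  component_right : L.IsComponent H.boundary
  uniform_left : IsUniform K J
  uniform_right : IsUniform H L
  inB : I.InBRank R
  inC_left' : K'.InC (R + 1)
  inC_right' : H'.InC (R + 1)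
  relReduction_left : IsRelReduction K' I K J ρJ
  relReduction_right : IsRelReduction H' I H L ρL
  connectingSeq : IsConnectingSeq (K.midsection J) (K.transition J) I (H.transition L)
    (H.midsection L) J.piMap (K.rhoMap J ∘ ρJ) (H.rhoMap L ∘ ρL) L.piMap

/-- The union of `K` and `H` along `I = K ∩ H`, with rank function `rk_K + rk_H - rk_I`. -/
def glue (K H I : CellData V) : CellData V where
  cells := K.cells ∪ H.cells
  rk := fun x => K.rk x + H.rk x - I.rk x
  rk_off := by
    intro x hx
    rw [Set.mem_union, not_or] at hx
    simp [K.rk_off x hx.1, H.rk_off x hx.2]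

end CellData

namespace CellData

variable {V W A B : Type*}

/-! ### Basic facts on cell complexes -/

/-! The union is controlled by how cells can cross `I`. Since `(K', I)` and `(H', I)` are
non-degenerate, a cell of the union lying inside a cell of `K'` belongs to `K'`, and a cell
containing a cell of `K'` outside `I` belongs to `K'` and is outside `I`. Hence rank monotonicity,
gaps, diamonds and cell-connectedness are inherited from one side. The exception is the intersection
of `x` in `K'` with `y` in `H'`, both outside `I`, and this is where connecting matters
(`Connects.exists_upper_bound`, `Connects.glues`). Uniformity lets incidence of a cell of `I` with
`x` or `y` be tested in the transitions. Two cells of `I` inside `x ∩ y` therefore have bounded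
images in both transitions, so the images have joins there, and reflectivity lifts these to a join
in `I` still inside `x` and `y`. So a maximal cell of `I` inside `x ∩ y` absorbs every vertex of `x
∩ y` and equals it.

For the manifold-like conditions, a top cell of `I` has exactly one co-face on each side: its image
in `J` is a boundary cell of rank `R`, and axiom r5 transports the co-face count. Such a cell
becomes an interior wall bridging the two dual graphs. Closedness of `I` and absence of pinches in
the boundary show that a top boundary cell outside `I` contains no cell of `I`
(`Attaches.not_subset_of_notMem`), so the new boundary is the disjoint union of what is left of the
two old ones.

Uniqueness: a relative reduction is an order isomorphism away from `I`, and by r3 the inclusion of a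
cell of `I` in an outer cell can be read off from the images. Both the outer part and its incidence
with `I` are thus determined by the target and the reduction on `I`.

For cobordisms, `L` shares no cell with `J`, so collars and midsections of components of `L` do not
see `K`. -/

theorem IsCC.cells_finite {K : CellData V} (h : K.IsCC) : K.cells.Finite :=
  h.finite.finite_subsets.subset h.subset_verts

theorem IsCC.rk_mono {K : CellData V} (h : K.IsCC) {x y : Set V} (hx : x ∈ K.cells)
    (hy : y ∈ K.cells) (hxy : x ⊆ y) : K.rk x ≤ K.rk y := by
  rcases hxy.eq_or_ssubset with rfl | hlt
  · exact le_rfl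
  · exact (h.rk_lt x hx y hy hlt).le

theorem IsCC.eq_of_subset {K : CellData V} (h : K.IsCC) {x y : Set V} (hx : x ∈ K.cells)
    (hy : y ∈ K.cells) (hxy : x ⊆ y) (hr : K.rk y ≤ K.rk x) : x = y := by
  rcases hxy.eq_or_ssubset with rfl | hlt
  · rfl
  · exact absurd (h.rk_lt x hx y hy hlt) (by omega)

theorem IsCC.singleton_mem {K : CellData V} (h : K.IsCC) {x : Set V} (hx : x ∈ K.cells) {v : V}
    (hv : v ∈ x) : {v} ∈ K.cells := h.subset_verts x hx hv

theorem IsCC.rk_singleton {K : CellData V} (h : K.IsCC) {v : V} (hv : {v} ∈ K.cells) :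
    K.rk {v} = 0 := (h.rk_eq_zero_iff _ hv).2 ⟨v, rfl⟩

theorem Rk_eq_of_forall_le {K : CellData V} {n : ℕ} (hle : ∀ x ∈ K.cells, K.rk x ≤ n)
    {x : Set V} (hx : x ∈ K.cells) (hr : K.rk x = n) : K.Rk = n := by
  apply le_antisymm
  · exact Nat.sInf_le hle
  · exact le_csInf ⟨n, hle⟩ fun m hm => hr ▸ hm x hx

theorem IsCC.rk_le_Rk {K : CellData V} (h : K.IsCC) {x : Set V} (hx : x ∈ K.cells) :
    K.rk x ≤ K.Rk := by
  -- Finiteness is needed: an unbounded rank would make the infimum that of the empty set, with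
  -- default value 0.
  have hne : {R | ∀ x ∈ K.cells, K.rk x ≤ R}.Nonempty := by
    obtain ⟨b, hb⟩ := (h.cells_finite.image K.rk).bddAbove
    exact ⟨b, fun x hx => hb ⟨x, hx, rfl⟩⟩
  exact Nat.sInf_mem hne x hx

theorem IsCC.exists_maximal_above {K : CellData V} (h : K.IsCC) {x : Set V} (hx : x ∈ K.cells) :
    ∃ z ∈ K.cells, x ⊆ z ∧ ∀ y ∈ K.cells, z ⊆ y → y = z := by
  obtain ⟨z, hxz, hz⟩ := h.cells_finite.exists_le_maximal hx
  exact ⟨z, hz.prop, hxz, fun y hy hzy => (hz.le_of_ge hy hzy).antisymm hzy⟩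

theorem IsCC.exists_top_above {K : CellData V} (h : K.IsCC) (hp : K.IsPure) {x : Set V}
    (hx : x ∈ K.cells) : ∃ z ∈ K.cells, x ⊆ z ∧ K.rk z = K.Rk := by
  obtain ⟨z, hz, hxz, hmax⟩ := h.exists_maximal_above hx
  exact ⟨z, hz, hxz, hp z hz hmax⟩

theorem IsCC.coface_finite {K : CellData V} (h : K.IsCC) (x : Set V) : (K.coface x).Finite :=
  h.cells_finite.subset fun _ hy => hy.1

theorem dual_eq_coface {K : CellData V} {y : Set V} (hy : K.rk y + 1 = K.Rk) :
    K.dual y = K.coface y := by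
  ext z
  simp only [dual, coface, Set.mem_ofPred_eq, hy]
  tauto

/-- Two cells with a common upper bound have a join, which lies below that bound. -/
theorem IsCC.exists_join {K : CellData V} (h : K.IsCC) {a b c : Set V} (ha : a ∈ K.cells)
    (hc : c ∈ K.cells) (hac : a ⊆ c) (hbc : b ⊆ c) :
    ∃ u, K.IsJoin {a, b} u ∧ u ⊆ c := by
  have hfin : {d | d ∈ K.cells ∧ a ⊆ d ∧ b ⊆ d}.Finite := h.cells_finite.subset fun _ hd => hd.1
  obtain ⟨u, -, hu⟩ := hfin.exists_le_minimal (a := c) ⟨hc, hac, hbc⟩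
  -- A minimal upper bound is least: its intersection with any other upper bound contains `a`, so it
  -- is non-empty and again a cell bounding both.
  have key : ∀ d ∈ K.cells, a ⊆ d → b ⊆ d → u ⊆ d := by
    intro d hd had hbd
    have hne : (u ∩ d).Nonempty := (h.nonempty a ha).mono (Set.subset_inter hu.prop.2.1 had)
    have := hu.le_of_le (y := u ∩ d)
      ⟨h.inter_mem u hu.prop.1 d hd hne, Set.subset_inter hu.prop.2.1 had,
        Set.subset_inter hu.prop.2.2 hbd⟩ Set.inter_subset_left
    exact fun v hv => (this hv).2
  refine ⟨u, ⟨hu.prop.1, ?_, ?_⟩, key c hc hac hbc⟩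
  · rintro s (rfl | rfl)
    exacts [hu.prop.2.1, hu.prop.2.2]
  · exact fun d hd hs => key d hd (hs a (by simp)) (hs b (by simp))

theorem boundary_rk {K : CellData V} {x : Set V} (hx : x ∈ K.boundary.cells) :
    K.boundary.rk x = K.rk x := Set.indicator_of_mem hx _

/-- A sub-maximal cell is in the boundary only if it has exactly one co-face. -/
theorem IsCC.coface_ncard_of_mem_boundary {K : CellData V} (h : K.IsCC) {y : Set V}
    (hy : y ∈ K.boundary.cells) (hr : K.rk y + 1 = K.Rk) : (K.coface y).ncard = 1 := by
  obtain ⟨hyK, y', hy', hr', hc, hyy'⟩ := hy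
  rwa [h.eq_of_subset hyK hy' hyy' (by omega)]

theorem IsCC.boundary_Rk {K : CellData V} (h : K.IsCC) {n : ℕ} (hn : K.Rk = n + 1)
    (hne : K.boundary.cells.Nonempty) : K.boundary.Rk = n := by
  obtain ⟨x, hx, y, hy, hr, hc, -⟩ := hne
  have hyb : y ∈ K.boundary.cells := ⟨hy, y, hy, hr, hc, subset_rfl⟩
  refine Rk_eq_of_forall_le ?_ hyb (by rw [boundary_rk hyb]; omega)
  rintro x hx
  rw [boundary_rk hx]
  obtain ⟨hxK, y, hy, hr, hc, hxy⟩ := hx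
  have := h.rk_mono hxK hy hxy
  omega

/-- Transports absence of pinches from one piece to the union. Adjacency is compared only inside
`S`, because the boundary dual graphs are known to agree only around cells outside `I`. -/
theorem reachable_induce_of_adj {D D' : SimpleGraph W} {S T : Set W} (hST : S ⊆ T)
    (hadj : ∀ a ∈ S, ∀ b ∈ S, D.Adj a b → D'.Adj a b) (hS : (D.induce S).Preconnected)
    {a b : W} (ha : a ∈ S) (hb : b ∈ S) :
    (D'.induce T).Reachable ⟨a, hST ha⟩ ⟨b, hST hb⟩ := by
  let f : D.induce S →g D'.induce T :=
    { toFun := fun z => ⟨z.1, hST z.2⟩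
      map_rel' := fun {p q} hpq => hadj p.1 p.2 q.1 q.2 hpq }
  exact (hS ⟨a, ha⟩ ⟨b, hb⟩).map f

/-! ### Complexes attached along a subcomplex of the boundary -/

/-- The part of the hypotheses on `(K, I)` used for gluing along `I`. -/
structure Attaches (K I : CellData V) (R : ℕ) : Prop where
  inC : K.InC (R + 1)
  inB : I.InB
  nonempty : I.cells.Nonempty
  rank_eq : I.Rk = R
  sub : I.IsSub K
  nonDegenerate : NonDegenerate K I
  coface_ncard : ∀ y ∈ I.cells, I.rk y = R → (K.coface y).ncard = 1

namespace Attaches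

variable {K I : CellData V} {R : ℕ}

theorem isCC (h : Attaches K I R) : K.IsCC := h.inC.isLocal.1

theorem mem_of_subset_verts (h : Attaches K I R) {x : Set V} (hx : x ∈ K.cells)
    (hxI : x ⊆ I.verts) : x ∈ I.cells := by
  by_contra hn
  exact h.nonDegenerate x hx hn hxI

theorem mem_of_subset (h : Attaches K I R) {x y : Set V} (hx : x ∈ K.cells) (hy : y ∈ I.cells)
    (hxy : x ⊆ y) : x ∈ I.cells :=
  h.mem_of_subset_verts hx (hxy.trans (h.inB.isCC.subset_verts y hy))

theorem rk_le (h : Attaches K I R) {x : Set V} (hx : x ∈ I.cells) : K.rk x ≤ R := by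
  rw [← h.sub.2 x hx, ← h.rank_eq]
  exact h.inB.isCC.rk_le_Rk hx

theorem exists_top_above (h : Attaches K I R) {x : Set V} (hx : x ∈ I.cells) :
    ∃ y ∈ I.cells, x ⊆ y ∧ K.rk y = R := by
  obtain ⟨y, hy, hxy, hr⟩ := h.inB.isCC.exists_top_above h.inB.closed.1.2.1 hx
  exact ⟨y, hy, hxy, by rw [← h.sub.2 y hy, hr, h.rank_eq]⟩

theorem top_mem_boundary (h : Attaches K I R) {y : Set V} (hy : y ∈ I.cells) (hr : K.rk y = R) :
    y ∈ K.boundary.cells :=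
  ⟨h.sub.1 hy, y, h.sub.1 hy, by rw [hr, h.inC.rank_eq],
    h.coface_ncard y hy (by rw [h.sub.2 y hy, hr]), subset_rfl⟩

theorem subset_boundary (h : Attaches K I R) : I.cells ⊆ K.boundary.cells := by
  intro x hx
  obtain ⟨y, hy, hxy, hr⟩ := h.exists_top_above hx
  obtain ⟨-, y', hy', hr', hc, hyy'⟩ := h.top_mem_boundary hy hr
  exact ⟨h.sub.1 hx, y', hy', hr', hc, hxy.trans hyy'⟩

theorem boundary_Rk (h : Attaches K I R) : K.boundary.Rk = R :=
  h.isCC.boundary_Rk h.inC.rank_eq (h.nonempty.mono h.subset_boundary)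

/-- A sub-maximal cell of `I` has exactly two co-faces in the closed complex `I`. -/
theorem coface_ncard_eq_two (h : Attaches K I R) {w z : Set V} (hw : w ∈ I.cells)
    (hr : K.rk w + 1 = R) (hz : z ∈ I.coface w) : (I.coface w).ncard = 2 := by
  have hrI : I.rk w + 1 = I.Rk := by rw [h.sub.2 w hw, hr, h.rank_eq]
  have h2 := h.inB.closed.1.2.2 w hw hrI
  have h1 : (I.coface w).ncard ≠ 1 := fun h1 => by
    have : w ∈ I.boundary.cells := ⟨hw, w, hw, hrI, h1, subset_rfl⟩
    rw [h.inB.closed.2] at this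
    exact this
  have h0 : 0 < (I.coface w).ncard :=
    (Set.ncard_pos (h.inB.isCC.coface_finite w)).2 ⟨z, hz⟩
  omega

/-- A sub-maximal boundary cell of `K` outside `I` contains no cell of `I`. -/
theorem not_subset_of_notMem (h : Attaches K I R) {x y : Set V} (hx : x ∈ I.cells)
    (hy : y ∈ K.boundary.cells) (hyI : y ∉ I.cells) (hr : K.rk y = R) : ¬ x ⊆ y := by
  intro hxy
  have hdual : ∀ {w z : Set V}, z ∈ K.boundary.dual w ↔
      z ∈ K.boundary.cells ∧ K.rk z = R ∧ w ⊆ z := by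
    intro w z
    constructor
    · rintro ⟨h1, h2, h3⟩
      rw [boundary_rk h1, h.boundary_Rk] at h2
      exact ⟨h1, h2, h3⟩
    · rintro ⟨h1, h2, h3⟩
      exact ⟨h1, by rw [boundary_rk h1, h.boundary_Rk, h2], h3⟩
  obtain ⟨t, ht, hxt, htr⟩ := h.exists_top_above hx
  have hpc := h.inC.nonPinching.2 x (h.subset_boundary hx)
  have htd : t ∈ K.boundary.dual x := hdual.2 ⟨h.subset_boundary ht, htr, hxt⟩
  have hyd : y ∈ K.boundary.dual x := hdual.2 ⟨hy, hr, hxy⟩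
  obtain ⟨p⟩ := hpc ⟨t, htd⟩ ⟨y, hyd⟩
  -- A path in the dual graph of the boundary from a top cell of `I` to `y` must leave `I`
  -- somewhere; let `w` be the wall crossed there.
  obtain ⟨d, -, hd1, hd2⟩ := p.exists_boundary_dart {z | z.1 ∈ I.cells} ht hyI
  obtain ⟨-, w, hw, -, hwr, hwd⟩ : K.boundary.dualGraph.Adj d.fst.1 d.snd.1 := d.adj
  rw [boundary_rk hw, h.boundary_Rk] at hwr
  have hz : d.fst.1 ∈ K.boundary.dual w := by rw [hwd]; simp
  have hz' : d.snd.1 ∈ K.boundary.dual w := by rw [hwd]; simp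
  have hzI : d.fst.1 ∈ I.cells := hd1
  have hwI : w ∈ I.cells := h.mem_of_subset hw.1 hzI hz.2.2
  have hsub : I.coface w ⊆ K.boundary.dual w := by
    rintro s ⟨hs, hws, hsr⟩
    refine hdual.2 ⟨h.subset_boundary hs, ?_, hws⟩
    rw [← h.sub.2 s hs, hsr, h.sub.2 w hwI, hwr]
  have hzc : d.fst.1 ∈ I.coface w :=
    ⟨hzI, hz.2.2, by rw [h.sub.2 _ hzI, h.sub.2 w hwI, hwr, (hdual.1 hz).2.1]⟩
  have hcard := h.coface_ncard_eq_two hwI hwr hzc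
  -- Since `I` is closed, `w` already has two co-faces in `I`. They exhaust the two boundary cells
  -- at `w`, so the path has not left `I`.
  have hle : (K.boundary.dual w).ncard ≤ (I.coface w).ncard := by
    rw [hcard, hwd]
    exact (Set.ncard_insert_le _ _).trans (by simp)
  have heq := Set.eq_of_subset_of_ncard_le hsub hle (by rw [hwd]; exact Set.toFinite _)
  rw [← heq] at hz'
  exact hd2 hz'.1

end Attaches

/-! ### The union as a cell complex -/

theorem glue_comm (K H I : CellData V) : glue K H I = glue H K I := by
  ext x
  · exact or_comm
  · simp only [glue, add_comm]

/-- Two complexes attached along `I = K ∩ H`, with meeting cells meeting in a cell of `I`. -/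
structure Glues (K H I : CellData V) (R : ℕ) : Prop where
  left : Attaches K I R
  right : Attaches H I R
  inter_eq : K.cells ∩ H.cells = I.cells
  meet : ∀ x ∈ K.cells, x ∉ I.cells → ∀ y ∈ H.cells, y ∉ I.cells → (x ∩ y).Nonempty →
    x ∩ y ∈ I.cells

namespace Glues

variable {K H I : CellData V} {R : ℕ}

theorem symm (h : Glues K H I R) : Glues H K I R where
  left := h.right
  right := h.left
  inter_eq := by rw [Set.inter_comm, h.inter_eq]
  meet := fun x hx hxI y hy hyI hne => by
    rw [Set.inter_comm] at hne ⊢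
    exact h.meet y hy hyI x hx hxI hne

theorem mem_inter (h : Glues K H I R) {x : Set V} (hK : x ∈ K.cells) (hH : x ∈ H.cells) :
    x ∈ I.cells := h.inter_eq ▸ ⟨hK, hH⟩

/-- The natural subtraction never truncates: on `I` the ranks of `H` and `I` agree and cancel, and
on the rest of `K` both are the default 0. -/
theorem rk_left (h : Glues K H I R) {x : Set V} (hx : x ∈ K.cells) :
    (glue K H I).rk x = K.rk x := by
  change K.rk x + H.rk x - I.rk x = K.rk x
  by_cases hI : x ∈ I.cells
  · rw [h.left.sub.2 x hI, ← h.right.sub.2 x hI, h.left.sub.2 x hI]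
    omega
  · rw [H.rk_off x fun hH => hI (h.mem_inter hx hH), I.rk_off x hI]
    omega

theorem rk_right (h : Glues K H I R) {x : Set V} (hx : x ∈ H.cells) :
    (glue K H I).rk x = H.rk x := by
  rw [glue_comm]
  exact h.symm.rk_left hx

/-- If `x` comes from `H`, each of its vertices lies in both complexes, hence in `I`, and
non-degeneracy of `(H, I)` puts `x` itself in `I`. -/
theorem mem_left_of_subset (h : Glues K H I R) {x y : Set V} (hx : x ∈ (glue K H I).cells)
    (hy : y ∈ K.cells) (hxy : x ⊆ y) : x ∈ K.cells := by
  rcases hx with hx | hx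
  · exact hx
  · refine h.left.sub.1 (h.right.mem_of_subset_verts hx fun v hv => ?_)
    exact h.mem_inter (h.left.isCC.singleton_mem hy (hxy hv)) (h.right.isCC.singleton_mem hx hv)

theorem mem_right_of_subset (h : Glues K H I R) {x y : Set V} (hx : x ∈ (glue K H I).cells)
    (hy : y ∈ H.cells) (hxy : x ⊆ y) : x ∈ H.cells :=
  h.symm.mem_left_of_subset (hx.symm) hy hxy

theorem mem_left_of_superset (h : Glues K H I R) {x y : Set V} (hx : x ∈ K.cells)
    (hxI : x ∉ I.cells) (hy : y ∈ (glue K H I).cells) (hxy : x ⊆ y) :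
    y ∈ K.cells ∧ y ∉ I.cells := by
  have hyH : y ∉ H.cells := fun hyH =>
    hxI (h.mem_inter hx (h.mem_right_of_subset (Or.inl hx) hyH hxy))
  exact ⟨hy.resolve_right hyH, fun hyI => hyH (h.right.sub.1 hyI)⟩

theorem face_left (h : Glues K H I R) {x : Set V} (hx : x ∈ K.cells) :
    (glue K H I).face x = K.face x := by
  ext z
  constructor
  · rintro ⟨hz, hzx, hr⟩
    have hzK := h.mem_left_of_subset hz hx hzx
    rw [h.rk_left hzK, h.rk_left hx] at hr
    exact ⟨hzK, hzx, hr⟩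
  · rintro ⟨hz, hzx, hr⟩
    exact ⟨Or.inl hz, hzx, by rwa [h.rk_left hz, h.rk_left hx]⟩

theorem coface_left (h : Glues K H I R) {x : Set V} (hx : x ∈ K.cells) (hxI : x ∉ I.cells) :
    (glue K H I).coface x = K.coface x := by
  ext z
  constructor
  · rintro ⟨hz, hxz, hr⟩
    have hzK := (h.mem_left_of_superset hx hxI hz hxz).1
    rw [h.rk_left hzK, h.rk_left hx] at hr
    exact ⟨hzK, hxz, hr⟩
  · rintro ⟨hz, hxz, hr⟩
    exact ⟨Or.inl hz, hxz, by rwa [h.rk_left hz, h.rk_left hx]⟩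

theorem coface_of_mem (h : Glues K H I R) {x : Set V} (hx : x ∈ I.cells) :
    (glue K H I).coface x = K.coface x ∪ H.coface x := by
  have hK := h.left.sub.1 hx
  have hH := h.right.sub.1 hx
  ext z
  constructor
  · rintro ⟨hz | hz, hxz, hr⟩
    · rw [h.rk_left hz, h.rk_left hK] at hr
      exact Or.inl ⟨hz, hxz, hr⟩
    · rw [h.rk_right hz, h.rk_right hH] at hr
      exact Or.inr ⟨hz, hxz, hr⟩
  · rintro (⟨hz, hxz, hr⟩ | ⟨hz, hxz, hr⟩)
    · exact ⟨Or.inl hz, hxz, by rwa [h.rk_left hz, h.rk_left hK]⟩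
    · exact ⟨Or.inr hz, hxz, by rwa [h.rk_right hz, h.rk_right hH]⟩

theorem restrict_left (h : Glues K H I R) {x : Set V} (hx : x ∈ K.cells) :
    (glue K H I).restrict x = K.restrict x := by
  have hc : {z | z ∈ (glue K H I).cells ∧ z ⊆ x} = {z | z ∈ K.cells ∧ z ⊆ x} := by
    ext z
    exact ⟨fun hz => ⟨h.mem_left_of_subset hz.1 hx hz.2, hz.2⟩, fun hz => ⟨Or.inl hz.1, hz.2⟩⟩
  rw [restrict, restrict, hc]
  ext z
  · rfl
  · by_cases hz : z ∈ {z | z ∈ K.cells ∧ z ⊆ x}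
    · simp only [ofCells, Set.indicator_of_mem hz, h.rk_left hz.1]
    · simp only [ofCells, Set.indicator_of_notMem hz]

theorem rk_lt_left (h : Glues K H I R) {x y : Set V} (hx : x ∈ (glue K H I).cells)
    (hy : y ∈ K.cells) (hxy : x ⊂ y) : (glue K H I).rk x < (glue K H I).rk y := by
  have hxK := h.mem_left_of_subset hx hy hxy.subset
  rw [h.rk_left hxK, h.rk_left hy]
  exact h.left.isCC.rk_lt x hxK y hy hxy

theorem no_gap_left (h : Glues K H I R) {x y : Set V} (hx : x ∈ (glue K H I).cells)
    (hy : y ∈ K.cells) (hxy : x ⊂ y) :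
    ∃ z ∈ (glue K H I).cells, z ⊆ y ∧ x ∈ (glue K H I).face z := by
  have hxK := h.mem_left_of_subset hx hy hxy.subset
  obtain ⟨z, hz, hzy, hxz⟩ := h.left.isCC.no_gap x hxK y hy hxy
  exact ⟨z, Or.inl hz, hzy, by rwa [h.face_left hz]⟩

theorem diamond_left (h : Glues K H I R) {x y : Set V} (hx : x ∈ (glue K H I).cells)
    (hy : y ∈ K.cells) (hxy : x ⊆ y) (hr : (glue K H I).rk x + 2 = (glue K H I).rk y) :
    ((glue K H I).coface x ∩ (glue K H I).face y).ncard = 2 := by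
  have hxK := h.mem_left_of_subset hx hy hxy
  rw [h.rk_left hxK, h.rk_left hy] at hr
  rw [h.face_left hy, ← h.left.isCC.diamond x hxK y hy hxy hr]
  congr 1
  ext z
  constructor
  · rintro ⟨⟨-, hxz, hzr⟩, hz⟩
    rw [h.rk_left hz.1, h.rk_left hxK] at hzr
    exact ⟨⟨hz.1, hxz, hzr⟩, hz⟩
  · rintro ⟨⟨-, hxz, hzr⟩, hz⟩
    exact ⟨⟨Or.inl hz.1, hxz, by rwa [h.rk_left hz.1, h.rk_left hxK]⟩, hz⟩

/-- The one cell complex axiom not settled inside a single side; the mixed case is exactly the field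
`meet`. -/
theorem inter_mem_left (h : Glues K H I R) {x y : Set V} (hx : x ∈ K.cells)
    (hy : y ∈ (glue K H I).cells) (hne : (x ∩ y).Nonempty) : x ∩ y ∈ (glue K H I).cells := by
  by_cases hyK : y ∈ K.cells
  · exact Or.inl (h.left.isCC.inter_mem x hx y hyK hne)
  · have hyH := hy.resolve_left hyK
    by_cases hxI : x ∈ I.cells
    · exact Or.inr (h.right.isCC.inter_mem x (h.right.sub.1 hxI) y hyH hne)
    · exact Or.inl (h.left.sub.1 (h.meet x hx hxI y hyH (fun hI => hyK (h.left.sub.1 hI)) hne))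

theorem isCC (h : Glues K H I R) : (glue K H I).IsCC where
  finite := h.left.isCC.finite.union h.right.isCC.finite
  nonempty := by
    rintro x (hx | hx)
    exacts [h.left.isCC.nonempty x hx, h.right.isCC.nonempty x hx]
  subset_verts := by
    rintro x (hx | hx) v hv
    exacts [Or.inl (h.left.isCC.singleton_mem hx hv), Or.inr (h.right.isCC.singleton_mem hx hv)]
  rk_eq_zero_iff := by
    rintro x (hx | hx)
    · rw [h.rk_left hx, h.left.isCC.rk_eq_zero_iff x hx]
    · rw [h.rk_right hx, h.right.isCC.rk_eq_zero_iff x hx]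
  rk_lt := by
    rintro x hx y (hy | hy) hxy
    · exact h.rk_lt_left hx hy hxy
    · rw [glue_comm] at hx ⊢
      exact h.symm.rk_lt_left hx hy hxy
  inter_mem := by
    rintro x (hx | hx) y hy hne
    · exact h.inter_mem_left hx hy hne
    · rw [glue_comm] at hy ⊢
      exact h.symm.inter_mem_left hx hy hne
  no_gap := by
    rintro x hx y (hy | hy) hxy
    · exact h.no_gap_left hx hy hxy
    · rw [glue_comm] at hx ⊢
      exact h.symm.no_gap_left hx hy hxy
  diamond := by
    rintro x hx y (hy | hy) hxy hr
    · exact h.diamond_left hx hy hxy hr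
    · rw [glue_comm] at hx hr ⊢
      exact h.symm.diamond_left hx hy hxy hr

/-! ### Rank, locality and non-singularity of the union -/

theorem Rk_eq (h : Glues K H I R) : (glue K H I).Rk = R + 1 := by
  obtain ⟨x, hx⟩ := h.left.inC.cells_nonempty
  obtain ⟨z, hz, -, hr⟩ := h.left.isCC.exists_top_above h.left.inC.nonSingular.2.1 hx
  rw [h.left.inC.rank_eq] at hr
  refine Rk_eq_of_forall_le ?_ (Or.inl hz : z ∈ (glue K H I).cells) (by rw [h.rk_left hz, hr])
  rintro y (hy | hy)
  · rw [h.rk_left hy, ← h.left.inC.rank_eq]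
    exact h.left.isCC.rk_le_Rk hy
  · rw [h.rk_right hy, ← h.right.inC.rank_eq]
    exact h.right.isCC.rk_le_Rk hy

theorem isGraphBased (h : Glues K H I R) : (glue K H I).IsGraphBased := by
  rintro e (he | he) hr
  · rw [h.rk_left he] at hr
    exact h.left.inC.isLocal.2.1.1 e he hr
  · rw [h.rk_right he] at hr
    exact h.right.inC.isLocal.2.1.1 e he hr

theorem reachable_left (h : Glues K H I R) {v w : V} (hv : v ∈ K.verts) (hw : w ∈ K.verts) :
    (glue K H I).edgeGraph.Reachable v w := by
  refine (h.left.inC.isLocal.2.1.2 v hv w hw).mono ?_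
  rintro a b ⟨hne, hab, hr⟩
  exact ⟨hne, Or.inl hab, by rw [h.rk_left hab, hr]⟩

theorem reachable_right (h : Glues K H I R) {v w : V} (hv : v ∈ H.verts) (hw : w ∈ H.verts) :
    (glue K H I).edgeGraph.Reachable v w := by
  rw [glue_comm]
  exact h.symm.reachable_left hv hw

theorem isLocal (h : Glues K H I R) : (glue K H I).IsLocal := by
  refine ⟨h.isCC, ⟨h.isGraphBased, ?_⟩, h.isGraphBased, ?_⟩
  -- Any vertex of the non-empty `I` is reachable from both sides.
  · obtain ⟨x, hx⟩ := h.left.nonempty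
    obtain ⟨u, hu⟩ := h.left.inB.isCC.nonempty x hx
    have huI := h.left.inB.isCC.singleton_mem hx hu
    have huK : u ∈ K.verts := h.left.sub.1 huI
    have huH : u ∈ H.verts := h.right.sub.1 huI
    have key : ∀ v ∈ (glue K H I).verts, (glue K H I).edgeGraph.Reachable v u := by
      rintro v (hv | hv)
      exacts [h.reachable_left hv huK, h.reachable_right hv huH]
    exact fun v hv w hw => (key v hv).trans (key w hw).symm
  · rintro x (hx | hx)
    · rw [h.restrict_left hx]
      exact h.left.inC.isLocal.2.2.2 x hx
    · rw [glue_comm, h.symm.restrict_left hx]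
      exact h.right.inC.isLocal.2.2.2 x hx

/-- A sub-maximal cell of `I` is the common face of one cell of `K` and one cell of `H`. -/
theorem coface_eq_pair (h : Glues K H I R) {y : Set V} (hy : y ∈ I.cells) (hr : K.rk y = R) :
    ∃ z z', z ≠ z' ∧ K.coface y = {z} ∧ H.coface y = {z'} ∧
      (glue K H I).coface y = {z, z'} := by
  have hrI : I.rk y = R := by rw [h.left.sub.2 y hy, hr]
  obtain ⟨z, hz⟩ := Set.ncard_eq_one.1 (h.left.coface_ncard y hy hrI)
  obtain ⟨z', hz'⟩ := Set.ncard_eq_one.1 (h.right.coface_ncard y hy hrI)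
  refine ⟨z, z', ?_, hz, hz', by rw [h.coface_of_mem hy, hz, hz', Set.singleton_union]⟩
  rintro rfl
  have h1 : z ∈ K.coface y := by rw [hz]; rfl
  have h2 : z ∈ H.coface y := by rw [hz']; rfl
  have := h.left.rk_le (h.mem_inter h1.1 h2.1)
  have := h1.2.2
  omega

theorem isPure (h : Glues K H I R) : (glue K H I).IsPure := by
  rintro x (hx | hx) hmax
  · rw [h.rk_left hx, h.Rk_eq, ← h.left.inC.rank_eq]
    exact h.left.inC.nonSingular.2.1 x hx fun y hy => hmax y (Or.inl hy)
  · rw [h.rk_right hx, h.Rk_eq, ← h.right.inC.rank_eq]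
    exact h.right.inC.nonSingular.2.1 x hx fun y hy => hmax y (Or.inr hy)

theorem coface_ncard_le_left (h : Glues K H I R) {y : Set V} (hy : y ∈ K.cells)
    (hr : K.rk y = R) : ((glue K H I).coface y).ncard ≤ 2 := by
  by_cases hyI : y ∈ I.cells
  · obtain ⟨z, z', hne, -, -, hc⟩ := h.coface_eq_pair hyI hr
    rw [hc, Set.ncard_pair hne]
  · rw [h.coface_left hy hyI]
    exact h.left.inC.nonSingular.2.2 y hy (by rw [hr, h.left.inC.rank_eq])

theorem isNonSingular (h : Glues K H I R) : (glue K H I).IsNonSingular := by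
  refine ⟨h.isGraphBased, h.isPure, ?_⟩
  rintro y (hy | hy) hr
  · rw [h.rk_left hy, h.Rk_eq] at hr
    exact h.coface_ncard_le_left hy (by omega)
  · rw [h.rk_right hy, h.Rk_eq] at hr
    rw [glue_comm]
    exact h.symm.coface_ncard_le_left hy (by omega)

/-! ### The boundary of the union -/

theorem notMem_of_coface_ncard_one (h : Glues K H I R) {y : Set V} (hr : K.rk y = R)
    (hc : ((glue K H I).coface y).ncard = 1) : y ∉ I.cells := fun hyI => by
  obtain ⟨z, z', hne, -, -, hc'⟩ := h.coface_eq_pair hyI hr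
  rw [hc', Set.ncard_pair hne] at hc
  omega

/-- Top cells of `I` have two co-faces in the union, so `y` is a boundary cell of `K` outside `I`;
absence of pinches in the boundary then keeps all of `I` away from `y`. -/
theorem boundary_subset_left (h : Glues K H I R) {x y : Set V} (hx : x ∈ (glue K H I).cells)
    (hy : y ∈ K.cells) (hr : K.rk y = R) (hc : ((glue K H I).coface y).ncard = 1) (hxy : x ⊆ y) :
    x ∈ K.boundary.cells ∧ x ∉ I.cells := by
  have hyI := h.notMem_of_coface_ncard_one hr hc
  have hr' : K.rk y + 1 = K.Rk := by rw [hr, h.left.inC.rank_eq]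
  rw [h.coface_left hy hyI] at hc
  exact ⟨⟨h.mem_left_of_subset hx hy hxy, y, hy, hr', hc, hxy⟩, fun hxI =>
    h.left.not_subset_of_notMem hxI ⟨hy, y, hy, hr', hc, subset_rfl⟩ hyI hr hxy⟩

theorem mem_boundary_left (h : Glues K H I R) {x : Set V} (hx : x ∈ K.boundary.cells)
    (hxI : x ∉ I.cells) : x ∈ (glue K H I).boundary.cells := by
  obtain ⟨hxK, y, hy, hr, hc, hxy⟩ := hx
  have hyI : y ∉ I.cells := fun hyI => hxI (h.left.mem_of_subset hxK hyI hxy)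
  refine ⟨Or.inl hxK, y, Or.inl hy, ?_, by rwa [h.coface_left hy hyI], hxy⟩
  rw [h.rk_left hy, hr, h.Rk_eq, h.left.inC.rank_eq]

theorem boundary_cells (h : Glues K H I R) : (glue K H I).boundary.cells =
    (K.boundary.cells \ I.cells) ∪ (H.boundary.cells \ I.cells) := by
  ext x
  constructor
  · rintro ⟨hx, y, hy | hy, hr, hc, hxy⟩
    · rw [h.rk_left hy, h.Rk_eq] at hr
      exact Or.inl (h.boundary_subset_left hx hy (by omega) hc hxy)
    · rw [h.rk_right hy, h.Rk_eq] at hr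
      rw [glue_comm] at hx hc
      exact Or.inr (h.symm.boundary_subset_left hx hy (by omega) hc hxy)
  · rintro (⟨hx, hxI⟩ | ⟨hx, hxI⟩)
    · exact h.mem_boundary_left hx hxI
    · rw [glue_comm]
      exact h.symm.mem_boundary_left hx hxI

theorem mem_boundary_iff_left (h : Glues K H I R) {x : Set V} (hx : x ∈ K.cells)
    (hxI : x ∉ I.cells) : x ∈ (glue K H I).boundary.cells ↔ x ∈ K.boundary.cells := by
  refine ⟨fun hb => ?_, fun hb => h.mem_boundary_left hb hxI⟩
  rw [h.boundary_cells] at hb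
  rcases hb with hb | hb
  · exact hb.1
  · exact absurd (h.mem_inter hx hb.1.1) hxI

theorem boundary_Rk (h : Glues K H I R) (hne : (glue K H I).boundary.cells.Nonempty) :
    (glue K H I).boundary.Rk = R := h.isCC.boundary_Rk h.Rk_eq hne

/-! ### Pinches -/

theorem dual_left (h : Glues K H I R) {x : Set V} (hx : x ∈ K.cells) (hxI : x ∉ I.cells) :
    (glue K H I).dual x = K.dual x := by
  ext z
  constructor
  · rintro ⟨hz, hr, hxz⟩
    have hzK := (h.mem_left_of_superset hx hxI hz hxz).1
    rw [h.rk_left hzK, h.Rk_eq, ← h.left.inC.rank_eq] at hr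
    exact ⟨hzK, hr, hxz⟩
  · rintro ⟨hz, hr, hxz⟩
    exact ⟨Or.inl hz, by rw [h.rk_left hz, hr, h.Rk_eq, h.left.inC.rank_eq], hxz⟩

theorem dual_subset_left (h : Glues K H I R) (x : Set V) : K.dual x ⊆ (glue K H I).dual x := by
  rintro z ⟨hz, hr, hxz⟩
  exact ⟨Or.inl hz, by rw [h.rk_left hz, hr, h.Rk_eq, h.left.inC.rank_eq], hxz⟩

theorem dual_of_mem (h : Glues K H I R) (x : Set V) :
    (glue K H I).dual x = K.dual x ∪ H.dual x := by
  refine Set.Subset.antisymm ?_ (Set.union_subset (h.dual_subset_left x) ?_)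
  · rintro z ⟨hz | hz, hr, hxz⟩
    · rw [h.rk_left hz, h.Rk_eq, ← h.left.inC.rank_eq] at hr
      exact Or.inl ⟨hz, hr, hxz⟩
    · rw [h.rk_right hz, h.Rk_eq, ← h.right.inC.rank_eq] at hr
      exact Or.inr ⟨hz, hr, hxz⟩
  · rw [glue_comm]
    exact h.symm.dual_subset_left x

/-- The wall between two distinct top cells has two co-faces, whereas a top cell of `I` has only one
in `K`. The wall is therefore outside `I`, where co-faces do not change under gluing. -/
theorem dualGraph_adj_left (h : Glues K H I R) {z z' : Set V} (hadj : K.dualGraph.Adj z z') :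
    (glue K H I).dualGraph.Adj z z' := by
  obtain ⟨hne, y, hy, -, hr, hd⟩ := hadj
  have hrR : K.rk y = R := by rw [h.left.inC.rank_eq] at hr; omega
  have hyI : y ∉ I.cells := fun hyI => by
    have h1 := h.left.coface_ncard y hyI (by rw [h.left.sub.2 y hyI, hrR])
    rw [← dual_eq_coface hr, hd, Set.ncard_pair hne] at h1
    omega
  have hrG : (glue K H I).rk y + 1 = (glue K H I).Rk := by rw [h.rk_left hy, h.Rk_eq, hrR]
  have hdG : (glue K H I).dual y = {z, z'} := by rw [h.dual_left hy hyI, hd]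
  refine ⟨hne, y, Or.inl hy, fun hb => ?_, hrG, hdG⟩
  have h1 := h.isCC.coface_ncard_of_mem_boundary hb hrG
  rw [← dual_eq_coface hrG, hdG, Set.ncard_pair hne] at h1
  omega

theorem reachable_dual_left (h : Glues K H I R) {x a b : Set V} (hx : x ∈ K.cells)
    (ha : a ∈ K.dual x) (hb : b ∈ K.dual x) :
    ((glue K H I).dualGraph.induce ((glue K H I).dual x)).Reachable
      ⟨a, h.dual_subset_left x ha⟩ ⟨b, h.dual_subset_left x hb⟩ :=
  reachable_induce_of_adj (h.dual_subset_left x) (fun _ _ _ _ => h.dualGraph_adj_left)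
    (h.left.inC.nonPinching.1 x hx) ha hb

theorem noPinch (h : Glues K H I R) : (glue K H I).NoPinch := by
  have hsymm : ∀ {x a b : Set V} (hx : x ∈ H.cells) (ha : a ∈ H.dual x) (hb : b ∈ H.dual x),
      ((glue K H I).dualGraph.induce ((glue K H I).dual x)).Reachable
        ⟨a, h.dual_of_mem x ▸ Or.inr ha⟩ ⟨b, h.dual_of_mem x ▸ Or.inr hb⟩ := by
    intro x a b hx ha hb
    refine reachable_induce_of_adj (fun z hz => h.dual_of_mem x ▸ Or.inr hz)
      (fun _ _ _ _ hadj => ?_) (h.right.inC.nonPinching.1 x hx) ha hb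
    rw [glue_comm]
    exact h.symm.dualGraph_adj_left hadj
  intro x hx
  by_cases hxI : x ∈ I.cells
  -- Around a cell of `I` the dual set splits into a part in `K` and a part in `H`, each connected.
  -- A top cell of `I` above `x` is a wall joining the two.
  · obtain ⟨y, hy, hxy, hr⟩ := h.left.exists_top_above hxI
    have hrG : (glue K H I).rk y + 1 = (glue K H I).Rk := by
      rw [h.rk_left (h.left.sub.1 hy), h.Rk_eq, hr]
    obtain ⟨z, z', hne, hz, hz', hc⟩ := h.coface_eq_pair hy hr
    have hdG : (glue K H I).dual y = {z, z'} := by rw [dual_eq_coface hrG, hc]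
    have hadj : (glue K H I).dualGraph.Adj z z' := by
      refine ⟨hne, y, Or.inl (h.left.sub.1 hy), fun hb => ?_, hrG, hdG⟩
      have h1 := h.isCC.coface_ncard_of_mem_boundary hb hrG
      rw [hc, Set.ncard_pair hne] at h1
      omega
    have hzK : z ∈ K.coface y := by rw [hz]; rfl
    have hzH : z' ∈ H.coface y := by rw [hz']; rfl
    have hzd : z ∈ K.dual x :=
      ⟨hzK.1, by rw [hzK.2.2, hr, h.left.inC.rank_eq], hxy.trans hzK.2.1⟩
    have hzd' : z' ∈ H.dual x := by
      refine ⟨hzH.1, ?_, hxy.trans hzH.2.1⟩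
      rw [hzH.2.2, ← h.right.sub.2 y hy, h.left.sub.2 y hy, hr, h.right.inC.rank_eq]
    have hmid : ((glue K H I).dualGraph.induce ((glue K H I).dual x)).Reachable
        ⟨z, h.dual_of_mem x ▸ Or.inl hzd⟩ ⟨z', h.dual_of_mem x ▸ Or.inr hzd'⟩ :=
      SimpleGraph.Adj.reachable hadj
    have key : ∀ a : (glue K H I).dual x,
        ((glue K H I).dualGraph.induce ((glue K H I).dual x)).Reachable a
          ⟨z, h.dual_of_mem x ▸ Or.inl hzd⟩ := by
      rintro ⟨a, ha⟩
      rcases (h.dual_of_mem x ▸ ha : a ∈ K.dual x ∪ H.dual x) with ha' | ha'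
      · exact h.reachable_dual_left (h.left.sub.1 hxI) ha' hzd
      · exact (hsymm (h.right.sub.1 hxI) ha' hzd').trans hmid.symm
    exact fun a b => (key a).trans (key b).symm
  · rcases hx with hx | hx
    · rintro ⟨a, ha⟩ ⟨b, hb⟩
      exact h.reachable_dual_left hx (h.dual_left hx hxI ▸ ha) (h.dual_left hx hxI ▸ hb)
    · rintro ⟨a, ha⟩ ⟨b, hb⟩
      have hd : (glue K H I).dual x = H.dual x := by
        rw [glue_comm, h.symm.dual_left hx hxI]
      exact hsymm hx (hd ▸ ha) (hd ▸ hb)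

theorem boundary_dual_left (h : Glues K H I R) {x : Set V} (hx : x ∈ K.boundary.cells)
    (hxI : x ∉ I.cells) : (glue K H I).boundary.dual x = K.boundary.dual x := by
  have hRK := h.left.boundary_Rk
  have hRG := h.boundary_Rk ⟨x, h.mem_boundary_left hx hxI⟩
  ext z
  constructor
  · rintro ⟨hz, hr, hxz⟩
    obtain ⟨hzK, hzI⟩ := h.mem_left_of_superset hx.1 hxI hz.1 hxz
    have hzb := (h.mem_boundary_iff_left hzK hzI).1 hz
    rw [boundary_rk hz, h.rk_left hzK, hRG] at hr
    exact ⟨hzb, by rw [boundary_rk hzb, hRK, hr], hxz⟩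
  · rintro ⟨hz, hr, hxz⟩
    have hzI : z ∉ I.cells := fun hzI => hxI (h.left.mem_of_subset hx.1 hzI hxz)
    have hzb := h.mem_boundary_left hz hzI
    rw [boundary_rk hz, hRK] at hr
    exact ⟨hzb, by rw [boundary_rk hzb, h.rk_left hz.1, hRG, hr], hxz⟩

/-- Around `x` the two boundaries have the same top cells, all outside `I`. Such cells contain no
cell of `I`, so the walls between them are also outside `I` and survive in the boundary of the
union. -/
theorem boundary_noPinch_left (h : Glues K H I R) {x : Set V} (hx : x ∈ K.boundary.cells)
    (hxI : x ∉ I.cells) :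
    ((glue K H I).boundary.dualGraph.induce ((glue K H I).boundary.dual x)).Preconnected := by
  have hd := h.boundary_dual_left hx hxI
  have hRK := h.left.boundary_Rk
  have hRG := h.boundary_Rk ⟨x, h.mem_boundary_left hx hxI⟩
  rintro ⟨a, ha⟩ ⟨b, hb⟩
  refine reachable_induce_of_adj hd.ge ?_ (h.left.inC.nonPinching.2 x hx) (hd ▸ ha) (hd ▸ hb)
  rintro z hz z' - ⟨hne, w, hw, -, hr, hwd⟩
  have hzI : z ∉ I.cells := fun hzI => hxI (h.left.mem_of_subset hx.1 hzI hz.2.2)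
  have hzw : z ∈ K.boundary.dual w := by rw [hwd]; simp
  have hwI : w ∉ I.cells := fun hwI =>
    h.left.not_subset_of_notMem hwI hz.1 hzI (by rw [← boundary_rk hz.1, hz.2.1, hRK]) hzw.2.2
  have hwb := h.mem_boundary_left hw hwI
  have hwdG : (glue K H I).boundary.dual w = {z, z'} := by rw [h.boundary_dual_left hw hwI, hwd]
  have hrG : (glue K H I).boundary.rk w + 1 = (glue K H I).boundary.Rk := by
    rw [boundary_rk hwb, h.rk_left hw.1, hRG, ← boundary_rk hw, hr, hRK]
  refine ⟨hne, w, hwb, ?_, hrG, hwdG⟩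
  -- The wall must not lie in the boundary of the boundary: by rank the witness `w'` would be `w`,
  -- which has two co-faces there rather than one.
  rintro ⟨-, w', hw', hr', hc, hww'⟩
  have heq : w = w' := by
    refine h.isCC.eq_of_subset hwb.1 hw'.1 hww' ?_
    rw [← boundary_rk hwb, ← boundary_rk hw']
    omega
  rw [← heq, ← dual_eq_coface hrG, hwdG, Set.ncard_pair hne] at hc
  omega

theorem boundary_noPinch (h : Glues K H I R) : (glue K H I).boundary.NoPinch := by
  intro x hx
  rw [h.boundary_cells] at hx
  rcases hx with ⟨hx, hxI⟩ | ⟨hx, hxI⟩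
  · exact h.boundary_noPinch_left hx hxI
  · rw [glue_comm]
    exact h.symm.boundary_noPinch_left hx hxI

theorem inC (h : Glues K H I R) : (glue K H I).InC (R + 1) where
  isLocal := h.isLocal
  cells_nonempty := h.left.inC.cells_nonempty.mono Set.subset_union_left
  nonSingular := h.isNonSingular
  nonPinching := ⟨h.noPinch, h.boundary_noPinch⟩
  rank_eq := h.Rk_eq

end Glues

/-! ### Uniform relative complexes -/

theorem mem_minOver {K J : CellData V} {a y : Set V} (hy : y ∈ K.minOver J a) :
    y ∈ K.collar J ∧ K.reducedCell J y = a :=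
  Minimal.prop (P := fun z => z ∈ K.collar J ∧ K.reducedCell J z = a) hy

theorem mem_minAbove {K J : CellData V} {S y : Set V} (hy : y ∈ K.minAbove J S) :
    y ∈ K.collar J ∧ S ⊆ y :=
  Minimal.prop (P := fun z => z ∈ K.collar J ∧ S ⊆ z) hy

/-- Cells are non-empty, so assuming that the value is a cell excludes the default `∅` and supplies
a member of the union defining `rhoMap`. Two members have the same minimal collar cells over them,
and any one of those has both as its reduced cell, so the member is unique. -/
theorem IsUniform.rhoMap_spec {K J : CellData V} (hu : IsUniform K J) {w : Set V}
    (hw : K.rhoMap J w ∈ (K.transition J).cells) :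
    K.minOver J (K.rhoMap J w) = K.minAbove J w ∧
      ∃ y ∈ K.minAbove J w, K.rhoMap J w = K.reducedCell J y := by
  have hover : ∀ c ∈ (K.transition J).cells, ∃ y, y ∈ K.minOver J c := by
    rintro c ⟨x, hx, rfl⟩
    have hfin : {z | z ∈ K.collar J ∧ K.reducedCell J z = K.reducedCell J x}.Finite :=
      hu.relCC.left.cells_finite.subset fun z hz => hz.1.1
    obtain ⟨y, -, hy⟩ := hfin.exists_le_minimal (a := x) ⟨hx, rfl⟩
    exact ⟨y, hy⟩
  obtain ⟨v, c, ⟨hc, hcm, hcr⟩, hv⟩ := hu.transition_inB.isCC.nonempty _ hw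
  have hcw : K.rhoMap J w = c := by
    refine Set.Subset.antisymm (Set.sUnion_subset ?_)
      (Set.subset_sUnion_of_mem (⟨hc, hcm, hcr⟩ : c ∈ {c | c ∈ (K.transition J).cells ∧
        K.minOver J c = K.minAbove J w ∧ (K.transition J).rk c = K.relRank J w}))
    rintro c' ⟨hc', hcm', -⟩
    obtain ⟨y, hy⟩ := hover c' hc'
    have hy' : y ∈ K.minOver J c := by rw [hcm, ← hcm']; exact hy
    rw [← (mem_minOver hy).2, ← (mem_minOver hy').2]
  obtain ⟨y, hy⟩ := hover c hc
  rw [hcw]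
  exact ⟨hcm, y, hcm ▸ hy, (mem_minOver hy).2.symm⟩

/-- In a uniform relative complex the incidence of a cell `w` of `J` with a cell `x` of the collar
is detected in the transition. -/
theorem IsUniform.rhoMap_subset_iff {K J : CellData V} (hu : IsUniform K J) {w x : Set V}
    (hwJ : w ∈ J.cells) (hw : K.rhoMap J w ∈ (K.transition J).cells) (hx : x ∈ K.collar J) :
    K.rhoMap J w ⊆ K.reducedCell J x ↔ w ⊆ x := by
  obtain ⟨hm, y, hy, hyr⟩ := hu.rhoMap_spec hw
  constructor
  · intro hsub
    rw [hyr] at hsub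
    have h1 := (hu.uniformity y (mem_minAbove hy).1 x hx).2 hsub
    exact (h1 ⟨hwJ, (mem_minAbove hy).2⟩ : w ∈ (J.restrict x).cells).2
  · intro hwx
    have hfin : {z | z ∈ K.collar J ∧ w ⊆ z}.Finite :=
      hu.relCC.left.cells_finite.subset fun z hz => hz.1.1
    obtain ⟨z, hzx, hz⟩ := hfin.exists_le_minimal (a := x) ⟨hx, hwx⟩
    -- A minimal collar cell containing `w` has reduced cell `K.rhoMap J w`, because the two
    -- families of minimal cells coincide.
    have hz' : z ∈ K.minOver J (K.rhoMap J w) := hm ▸ hz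
    rw [← (mem_minOver hz').2]
    refine (hu.uniformity z hz.prop.1 x hx).1 ?_
    rintro s ⟨hs, hsz⟩
    exact ⟨hs, hsz.trans hzx⟩

/-! ### Relative reductions -/

namespace IsRelReduction

variable {K J : CellData A} {K' I : CellData V} {ρ : Set V → Set A}

theorem mem_right (h : IsRelReduction K' I K J ρ) {x : Set V} (hx : x ∈ I.cells) :
    ρ x ∈ J.cells := h.image_eq ▸ ⟨x, hx, rfl⟩

theorem mem_diff (h : IsRelReduction K' I K J ρ) {x : Set V} (hx : x ∈ K'.cells)
    (hxI : x ∉ I.cells) : ρ x ∈ K.cells ∧ ρ x ∉ J.cells := h.bijOn.mapsTo ⟨hx, hxI⟩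

/-- Axiom r3 lifts `ρ x` to some `x'` above `w` with the rank of `ρ x`. Its image is not in `J`, so
`x'` is outside `I`, and injectivity there forces `x' = x`. -/
theorem subset_and_rk_eq (h : IsRelReduction K' I K J ρ) {w x : Set V} (hw : w ∈ K'.cells)
    (hx : x ∈ K'.cells) (hxI : x ∉ I.cells) (hwx : ρ w ⊆ ρ x) :
    w ⊆ x ∧ K'.rk x = K.rk (ρ x) := by
  obtain ⟨hxK, hxJ⟩ := h.mem_diff hx hxI
  obtain ⟨x', hx', hwx', hr, he⟩ := h.reduction.r3 w hw (ρ x) hxK hwx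
  have hxI' : x' ∉ I.cells := fun hI => hxJ (he ▸ h.mem_right hI)
  have : x' = x := h.bijOn.injOn ⟨hx', hxI'⟩ ⟨hx, hxI⟩ he
  subst this
  exact ⟨hwx', hr⟩

theorem subset_iff_of_notMem (h : IsRelReduction K' I K J ρ) {w x : Set V} (hw : w ∈ K'.cells)
    (hx : x ∈ K'.cells) (hxI : x ∉ I.cells) : w ⊆ x ↔ ρ w ⊆ ρ x :=
  ⟨h.ccHom.mono w hw x hx, fun hs => (h.subset_and_rk_eq hw hx hxI hs).1⟩

theorem rk_eq (h : IsRelReduction K' I K J ρ) {x : Set V} (hx : x ∈ K'.cells)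
    (hxI : x ∉ I.cells) : K'.rk x = K.rk (ρ x) := (h.subset_and_rk_eq hx hx hxI subset_rfl).2

theorem rk_le (h : IsRelReduction K' I K J ρ) {x : Set V} (hx : x ∈ K'.cells) :
    K'.rk x ≤ K.rk (ρ x) := by
  obtain ⟨x', hx', hxx', hr, -⟩ :=
    h.reduction.r3 x hx (ρ x) (h.ccHom.mapsTo hx) subset_rfl
  rw [← hr]
  exact h.relCC_source.left.rk_mono hx hx' hxx'

/-- A relative reduction onto a non-degenerate relative cc has a non-degenerate source. -/
theorem nonDegenerate (h : IsRelReduction K' I K J ρ) (hd : NonDegenerate K J) :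
    NonDegenerate K' I := by
  intro x hx hxI hsub
  obtain ⟨hxK, hxJ⟩ := h.mem_diff hx hxI
  obtain ⟨w, hw, hwJ⟩ := Set.not_subset.1 (hd _ hxK hxJ)
  -- A vertex of `ρ x` outside `J` lifts to a cell outside `I` of the same rank, hence to a vertex
  -- of `x` outside `I`.
  have hwK : {w} ∈ K.cells := h.relCC_target.left.singleton_mem hxK hw
  obtain ⟨z, ⟨hz, hzI⟩, hzw⟩ := h.bijOn.surjOn ⟨hwK, hwJ⟩
  have hz0 : K'.rk z = 0 := by
    rw [h.rk_eq hz hzI, hzw, h.relCC_target.left.rk_singleton hwK]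
  obtain ⟨v, rfl⟩ := (h.relCC_source.left.rk_eq_zero_iff z hz).1 hz0
  have hzx : {v} ⊆ x := by
    rw [h.subset_iff_of_notMem hz hx hxI, hzw]
    exact Set.singleton_subset_iff.2 hw
  exact hzI (hsub (hzx rfl))

theorem mem_collar (h : IsRelReduction K' I K J ρ) (hd : NonDegenerate K J) {x : Set V}
    (hx : x ∈ K'.cells) (hxI : x ∉ I.cells) {v : V} (hvx : v ∈ x) (hv : {v} ∈ I.cells) :
    ρ x ∈ K.collar J := by
  obtain ⟨hxK, hxJ⟩ := h.mem_diff hx hxI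
  refine ⟨hxK, ?_, fun he => hd _ hxK hxJ (Set.inter_eq_left.1 he)⟩
  have hρv := h.mem_right hv
  obtain ⟨u, hu⟩ := h.relCC_target.right.nonempty _ hρv
  have hsub : ρ {v} ⊆ ρ x :=
    h.ccHom.mono _ (h.relCC_source.sub.1 hv) _ hx (Set.singleton_subset_iff.2 hvx)
  exact ⟨u, hsub hu, h.relCC_target.right.subset_verts _ hρv hu⟩

theorem attaches {R : ℕ} (h : IsRelReduction K' I K J ρ) (hd : NonDegenerate K J)
    (hK : K.InC (R + 1)) (hK' : K'.InC (R + 1)) (hI : I.InB) (hne : I.cells.Nonempty)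
    (hRk : I.Rk = R) (hJ : J.cells ⊆ K.boundary.cells) : Attaches K' I R where
  inC := hK'
  inB := hI
  nonempty := hne
  rank_eq := hRk
  sub := h.relCC_source.sub
  nonDegenerate := h.nonDegenerate hd
  coface_ncard := by
    intro y hy hr
    have hCC := h.relCC_target.left
    have hyK' := h.relCC_source.sub.1 hy
    have hyr : K'.rk y = R := by rw [← h.relCC_source.sub.2 y hy, hr]
    -- The rank of `ρ y` is squeezed to `R`: reductions do not lower rank in passing to the image,
    -- and a boundary cell has rank at most `R`. So `ρ y` has a single co-face `z`.
    have hρ := hJ (h.mem_right hy)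
    obtain ⟨hρK, t, ht, htr, -, hρt⟩ := id hρ
    have h1 := hCC.rk_mono hρK ht hρt
    have h2 := h.rk_le hyK'
    have hKR := hK.rank_eq
    have hρr : K.rk (ρ y) = R := by omega
    have hc := hCC.coface_ncard_of_mem_boundary hρ (by omega)
    obtain ⟨z, hz⟩ := Set.ncard_eq_one.1 hc
    have hz' : z ∈ K.coface (ρ y) := by rw [hz]; rfl
    rw [← h.reduction.r5 y hyK' (by rw [hyr, hρr]) z hz']
    congr 1
    -- By r5 just one co-face of `y` maps to `z`, and every co-face does: its image has the maximal
    -- rank `R + 1` and contains `ρ y`.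
    refine (Set.inter_eq_left.2 ?_).symm
    rintro c ⟨hcK, hyc, hcr⟩
    refine ⟨hcK, ?_⟩
    have h3 := h.rk_le hcK
    have h4 := hCC.rk_le_Rk (h.ccHom.mapsTo hcK)
    have : ρ c ∈ K.coface (ρ y) :=
      ⟨h.ccHom.mapsTo hcK, h.ccHom.mono y hyK' c hcK hyc, by omega⟩
    rw [hz] at this
    exact this

end IsRelReduction

theorem IsComponent.nonempty {J N : CellData V} (h : J.IsComponent N) : J.cells.Nonempty := by
  obtain ⟨v, hv, rfl⟩ := h
  refine ⟨{v}, hv, ?_⟩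
  rintro w rfl
  exact SimpleGraph.Reachable.refl _

theorem IsComponent.cells_subset {J N : CellData V} (h : J.IsComponent N) :
    J.cells ⊆ N.cells := by
  obtain ⟨v, hv, rfl⟩ := h
  exact fun x hx => hx.1

/-! ### Connected complexes can be glued -/

namespace Connects

variable {R : ℕ} {K J : CellData A} {H L : CellData B} {I K' H' : CellData V}
  {ρJ : Set V → Set A} {ρL : Set V → Set B}

theorem nonempty (h : Connects R K J H L I K' H' ρJ ρL) : I.cells.Nonempty := by
  obtain ⟨y, hy⟩ := h.component_left.nonempty
  rw [← h.relReduction_left.image_eq] at hy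
  obtain ⟨x, hx, -⟩ := hy
  exact ⟨x, hx⟩

theorem attaches_left (h : Connects R K J H L I K' H' ρJ ρL) : Attaches K' I R :=
  h.relReduction_left.attaches h.uniform_left.nonDegenerate h.inC_left h.inC_left' h.inB.1
    h.nonempty (h.inB.2 h.nonempty) h.component_left.cells_subset

theorem attaches_right (h : Connects R K J H L I K' H' ρJ ρL) : Attaches H' I R :=
  h.relReduction_right.attaches h.uniform_right.nonDegenerate h.inC_right h.inC_right' h.inB.1
    h.nonempty (h.inB.2 h.nonempty) h.component_right.cells_subset

/-- Cells `x`, `y` on the two sides contain, with any two cells of `I`, a cell of `I` above both: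
this is reflectivity. -/
theorem exists_upper_bound (h : Connects R K J H L I K' H' ρJ ρL) {x y w w' : Set V} {v : V}
    (hx : x ∈ K'.cells) (hxI : x ∉ I.cells) (hy : y ∈ H'.cells) (hyI : y ∉ I.cells)
    (hv : {v} ∈ I.cells) (hvx : v ∈ x) (hvy : v ∈ y)
    (hw : w ∈ I.cells) (hw' : w' ∈ I.cells) (hwx : w ⊆ x) (hwy : w ⊆ y) (hwx' : w' ⊆ x)
    (hwy' : w' ⊆ y) : ∃ u ∈ I.cells, w ⊆ u ∧ w' ⊆ u ∧ u ⊆ x ∧ u ⊆ y := by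
  have hredJ := h.connectingSeq.reduction_left.mapsTo
  have hredL := h.connectingSeq.reduction_right.mapsTo
  have hcolJ := h.relReduction_left.mem_collar h.uniform_left.nonDegenerate hx hxI hvx hv
  have hcolL := h.relReduction_right.mem_collar h.uniform_right.nonDegenerate hy hyI hvy hv
  have keyJ : ∀ s ∈ I.cells,
      ((K.rhoMap J ∘ ρJ) s ⊆ K.reducedCell J (ρJ x) ↔ s ⊆ x) := fun s hs =>
    (h.uniform_left.rhoMap_subset_iff (h.relReduction_left.mem_right hs) (hredJ hs) hcolJ).trans
      (h.relReduction_left.subset_iff_of_notMem (h.relReduction_left.relCC_source.sub.1 hs)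
        hx hxI).symm
  have keyL : ∀ s ∈ I.cells,
      ((H.rhoMap L ∘ ρL) s ⊆ H.reducedCell L (ρL y) ↔ s ⊆ y) := fun s hs =>
    (h.uniform_right.rhoMap_subset_iff (h.relReduction_right.mem_right hs) (hredL hs) hcolL).trans
      (h.relReduction_right.subset_iff_of_notMem (h.relReduction_right.relCC_source.sub.1 hs)
        hy hyI).symm
  -- The reduced cell of `ρJ x` bounds both images in the transition, so their join exists and lies
  -- below it; likewise for `y`. These are the two joins that reflectivity requires.
  obtain ⟨a, ha, hax⟩ := h.uniform_left.transition_inB.isCC.exists_join (hredJ hw)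
    ⟨_, hcolJ, rfl⟩ ((keyJ w hw).2 hwx) ((keyJ w' hw').2 hwx')
  obtain ⟨b, hb, hby⟩ := h.uniform_right.transition_inB.isCC.exists_join (hredL hw)
    ⟨_, hcolL, rfl⟩ ((keyL w hw).2 hwy) ((keyL w' hw').2 hwy')
  obtain ⟨u, ⟨hu, hup, -⟩, hua, hub⟩ := h.connectingSeq.reflective w hw w' hw' a b ha hb
  exact ⟨u, hu, hup w (by simp), hup w' (by simp), (keyJ u hu).1 (hua.trans_subset hax),
    (keyL u hu).1 (hub.trans_subset hby)⟩

theorem glues (h : Connects R K J H L I K' H' ρJ ρL) (hI : K'.cells ∩ H'.cells = I.cells) :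
    Glues K' H' I R where
  left := h.attaches_left
  right := h.attaches_right
  inter_eq := hI
  meet := by
    intro x hx hxI y hy hyI hne
    have hv : ∀ v ∈ x ∩ y, {v} ∈ I.cells := fun v hv => hI ▸
      ⟨h.attaches_left.isCC.singleton_mem hx hv.1, h.attaches_right.isCC.singleton_mem hy hv.2⟩
    obtain ⟨v₀, hv₀⟩ := hne
    have hfin : {w | w ∈ I.cells ∧ w ⊆ x ∩ y}.Finite :=
      h.inB.1.isCC.cells_finite.subset fun w hw => hw.1
    obtain ⟨m, -, hm⟩ := hfin.exists_le_maximal (a := {v₀})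
      ⟨hv v₀ hv₀, Set.singleton_subset_iff.2 hv₀⟩
    have hsub := Set.subset_inter_iff.1 hm.prop.2
    suffices x ∩ y ⊆ m by
      rw [this.antisymm hm.prop.2]
      exact hm.prop.1
    -- A cell of `I` inside `x ∩ y` above both `m` and `{v}` must be `m`, by maximality, so `v` lies
    -- in `m`.
    intro v hvxy
    obtain ⟨u, hu, hmu, hvu, hux, huy⟩ := h.exists_upper_bound hx hxI hy hyI (hv v hvxy) hvxy.1
      hvxy.2 hm.prop.1 (hv v hvxy) hsub.1 hsub.2 (Set.singleton_subset_iff.2 hvxy.1)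
      (Set.singleton_subset_iff.2 hvxy.2)
    exact hm.le_of_ge ⟨hu, Set.subset_inter hux huy⟩ hmu (hvu rfl)

end Connects

/-! ### Uniqueness -/

/-- The transfer between two relative reductions `ρ`, `σ` with the same target, where `σ` is defined
on `(K'', I)`. -/
noncomputable def transfer (I K'' : CellData V) (ρ σ : Set V → Set A) (x : Set V) : Set V :=
  Function.invFunOn σ (K''.cells \ I.cells) (ρ x)

namespace IsRelReduction

variable {K J : CellData A} {I K' K'' : CellData V} {ρ σ : Set V → Set A}

theorem transfer_spec (hρ : IsRelReduction K' I K J ρ) (hσ : IsRelReduction K'' I K J σ)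
    {x : Set V} (hx : x ∈ K'.cells) (hxI : x ∉ I.cells) :
    transfer I K'' ρ σ x ∈ K''.cells ∧ transfer I K'' ρ σ x ∉ I.cells ∧
      σ (transfer I K'' ρ σ x) = ρ x := by
  have hmem : ∃ a ∈ K''.cells \ I.cells, σ a = ρ x := hσ.bijOn.surjOn (hρ.mem_diff hx hxI)
  have h := Function.invFunOn_mem hmem
  exact ⟨h.1, h.2, Function.invFunOn_eq hmem⟩

theorem transfer_rk (hρ : IsRelReduction K' I K J ρ) (hσ : IsRelReduction K'' I K J σ)
    {x : Set V} (hx : x ∈ K'.cells) (hxI : x ∉ I.cells) :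
    K''.rk (transfer I K'' ρ σ x) = K'.rk x := by
  obtain ⟨h1, h2, h3⟩ := hρ.transfer_spec hσ hx hxI
  rw [hσ.rk_eq h1 h2, h3, hρ.rk_eq hx hxI]

theorem transfer_transfer (hρ : IsRelReduction K' I K J ρ) (hσ : IsRelReduction K'' I K J σ)
    {x : Set V} (hx : x ∈ K'.cells) (hxI : x ∉ I.cells) :
    transfer I K' σ ρ (transfer I K'' ρ σ x) = x := by
  obtain ⟨h1, h2, h3⟩ := hρ.transfer_spec hσ hx hxI
  obtain ⟨h4, h5, h6⟩ := hσ.transfer_spec hρ h1 h2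
  exact hρ.bijOn.injOn ⟨h4, h5⟩ ⟨hx, hxI⟩ (h6.trans h3)

theorem transfer_mono (hρ : IsRelReduction K' I K J ρ) (hσ : IsRelReduction K'' I K J σ)
    {w x : Set V} (hw : w ∈ K'.cells) (hwI : w ∉ I.cells) (hx : x ∈ K'.cells)
    (hxI : x ∉ I.cells) (hwx : w ⊆ x) : transfer I K'' ρ σ w ⊆ transfer I K'' ρ σ x := by
  obtain ⟨h1, h2, h3⟩ := hρ.transfer_spec hσ hx hxI
  obtain ⟨h4, h5, h6⟩ := hρ.transfer_spec hσ hw hwI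
  rw [hσ.subset_iff_of_notMem h4 h1 h2, h3, h6]
  exact hρ.ccHom.mono w hw x hx hwx

/-- Inclusion of a cell of `I` in an outer cell is detected on images, and the images of `w` under
`ρ` and `σ` agree. This is where the data on `I` enter uniqueness. -/
theorem subset_transfer (hρ : IsRelReduction K' I K J ρ) (hσ : IsRelReduction K'' I K J σ)
    (hag : ∀ x ∈ I.cells, σ x = ρ x) {w x : Set V} (hw : w ∈ I.cells) (hx : x ∈ K'.cells)
    (hxI : x ∉ I.cells) (hwx : w ⊆ x) : w ⊆ transfer I K'' ρ σ x := by
  obtain ⟨h1, h2, h3⟩ := hρ.transfer_spec hσ hx hxI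
  rw [hσ.subset_iff_of_notMem (hσ.relCC_source.sub.1 hw) h1 h2, h3, hag w hw]
  exact hρ.ccHom.mono w (hρ.relCC_source.sub.1 hw) x hx hwx

end IsRelReduction

open Classical in
/-- The map which is the identity on `I`, is `f` on the rest of `K` and `g` elsewhere. -/
noncomputable def glueMap (I K : CellData V) (f g : Set V → Set V) (x : Set V) : Set V :=
  if x ∈ I.cells then x else if x ∈ K.cells then f x else g x

namespace Connects

variable {R : ℕ} {K J : CellData A} {H L : CellData B} {I K' H' K'' H'' : CellData V}
  {ρJ σJ : Set V → Set A} {ρL σL : Set V → Set B}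

/-- The comparison map between two complexes obtained by gluing. -/
noncomputable def comparison (I K' K'' H'' : CellData V) (ρJ σJ : Set V → Set A)
    (ρL σL : Set V → Set B) : Set V → Set V :=
  glueMap I K' (transfer I K'' ρJ σJ) (transfer I H'' ρL σL)

theorem comparison_of_mem {x : Set V} (hx : x ∈ I.cells) :
    comparison I K' K'' H'' ρJ σJ ρL σL x = x := if_pos hx

theorem comparison_of_mem_left {x : Set V} (hx : x ∈ K'.cells) (hxI : x ∉ I.cells) :
    comparison I K' K'' H'' ρJ σJ ρL σL x = transfer I K'' ρJ σJ x := by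
  rw [comparison, glueMap, if_neg hxI, if_pos hx]

theorem comparison_of_mem_right (hI : K'.cells ∩ H'.cells = I.cells) {x : Set V}
    (hx : x ∈ H'.cells) (hxI : x ∉ I.cells) :
    comparison I K' K'' H'' ρJ σJ ρL σL x = transfer I H'' ρL σL x := by
  rw [comparison, glueMap, if_neg hxI, if_neg fun hK => hxI (hI ▸ ⟨hK, hx⟩)]

theorem comparison_mem_rk (h : Connects R K J H L I K' H' ρJ ρL)
    (hI : K'.cells ∩ H'.cells = I.cells) (h' : Connects R K J H L I K'' H'' σJ σL)
    (hI' : K''.cells ∩ H''.cells = I.cells) {x : Set V} (hx : x ∈ (glue K' H' I).cells) :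
    comparison I K' K'' H'' ρJ σJ ρL σL x ∈ (glue K'' H'' I).cells ∧
      (glue K'' H'' I).rk (comparison I K' K'' H'' ρJ σJ ρL σL x) = (glue K' H' I).rk x := by
  have hg := h.glues hI
  have hg' := h'.glues hI'
  by_cases hxI : x ∈ I.cells
  · rw [comparison_of_mem hxI]
    refine ⟨Or.inl (hg'.left.sub.1 hxI), ?_⟩
    rw [hg'.rk_left (hg'.left.sub.1 hxI), hg.rk_left (hg.left.sub.1 hxI), ← hg.left.sub.2 x hxI,
      hg'.left.sub.2 x hxI]
  · rcases hx with hx | hx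
    · have hm := (h.relReduction_left.transfer_spec h'.relReduction_left hx hxI).1
      rw [comparison_of_mem_left hx hxI, hg'.rk_left hm, hg.rk_left hx]
      exact ⟨Or.inl hm, h.relReduction_left.transfer_rk h'.relReduction_left hx hxI⟩
    · have hm := (h.relReduction_right.transfer_spec h'.relReduction_right hx hxI).1
      rw [comparison_of_mem_right hI hx hxI, hg'.rk_right hm, hg.rk_right hx]
      exact ⟨Or.inr hm, h.relReduction_right.transfer_rk h'.relReduction_right hx hxI⟩

theorem comparison_mono (h : Connects R K J H L I K' H' ρJ ρL)
    (hI : K'.cells ∩ H'.cells = I.cells) (h' : Connects R K J H L I K'' H'' σJ σL)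
    (hJ : ∀ x ∈ I.cells, σJ x = ρJ x) (hL : ∀ x ∈ I.cells, σL x = ρL x) {x y : Set V}
    (hx : x ∈ (glue K' H' I).cells) (hy : y ∈ (glue K' H' I).cells) (hxy : x ⊆ y) :
    comparison I K' K'' H'' ρJ σJ ρL σL x ⊆ comparison I K' K'' H'' ρJ σJ ρL σL y := by
  have hg := h.glues hI
  by_cases hyI : y ∈ I.cells
  · have hxK := hg.mem_left_of_subset hx (hg.left.sub.1 hyI) hxy
    rwa [comparison_of_mem hyI, comparison_of_mem (hg.left.mem_of_subset hxK hyI hxy)]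
  · rcases hy with hy | hy
    · have hxK := hg.mem_left_of_subset hx hy hxy
      rw [comparison_of_mem_left hy hyI]
      by_cases hxI : x ∈ I.cells
      · rw [comparison_of_mem hxI]
        exact h.relReduction_left.subset_transfer h'.relReduction_left hJ hxI hy hyI hxy
      · rw [comparison_of_mem_left hxK hxI]
        exact h.relReduction_left.transfer_mono h'.relReduction_left hxK hxI hy hyI hxy
    · have hxH := hg.mem_right_of_subset hx hy hxy
      rw [comparison_of_mem_right hI hy hyI]
      by_cases hxI : x ∈ I.cells
      · rw [comparison_of_mem hxI]
        exact h.relReduction_right.subset_transfer h'.relReduction_right hL hxI hy hyI hxy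
      · rw [comparison_of_mem_right hI hxH hxI]
        exact h.relReduction_right.transfer_mono h'.relReduction_right hxH hxI hy hyI hxy

theorem comparison_comparison (h : Connects R K J H L I K' H' ρJ ρL)
    (hI : K'.cells ∩ H'.cells = I.cells) (h' : Connects R K J H L I K'' H'' σJ σL)
    (hI' : K''.cells ∩ H''.cells = I.cells) {x : Set V} (hx : x ∈ (glue K' H' I).cells) :
    comparison I K'' K' H' σJ ρJ σL ρL (comparison I K' K'' H'' ρJ σJ ρL σL x) = x := by
  by_cases hxI : x ∈ I.cells
  · rw [comparison_of_mem hxI, comparison_of_mem hxI]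
  · rcases hx with hx | hx
    · obtain ⟨h1, h2, -⟩ := h.relReduction_left.transfer_spec h'.relReduction_left hx hxI
      rw [comparison_of_mem_left hx hxI, comparison_of_mem_left h1 h2]
      exact h.relReduction_left.transfer_transfer h'.relReduction_left hx hxI
    · obtain ⟨h1, h2, -⟩ := h.relReduction_right.transfer_spec h'.relReduction_right hx hxI
      rw [comparison_of_mem_right hI hx hxI, comparison_of_mem_right hI' h1 h2]
      exact h.relReduction_right.transfer_transfer h'.relReduction_right hx hxI

theorem comparison_isCCHom (h : Connects R K J H L I K' H' ρJ ρL)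
    (hI : K'.cells ∩ H'.cells = I.cells) (h' : Connects R K J H L I K'' H'' σJ σL)
    (hI' : K''.cells ∩ H''.cells = I.cells) (hJ : ∀ x ∈ I.cells, σJ x = ρJ x)
    (hL : ∀ x ∈ I.cells, σL x = ρL x) :
    IsCCHom (glue K' H' I) (glue K'' H'' I) (comparison I K' K'' H'' ρJ σJ ρL σL) where
  mapsTo := fun _ hx => (h.comparison_mem_rk hI h' hI' hx).1
  mono := fun _ hx _ hy hxy => h.comparison_mono hI h' hJ hL hx hy hxy
  rank_lift := by
    rintro _ ⟨x, hx, rfl⟩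
    exact ⟨x, hx, (h.comparison_mem_rk hI h' hI' hx).2.symm, rfl⟩

theorem isomorphic_glue (h : Connects R K J H L I K' H' ρJ ρL)
    (hI : K'.cells ∩ H'.cells = I.cells) (h' : Connects R K J H L I K'' H'' σJ σL)
    (hI' : K''.cells ∩ H''.cells = I.cells) (hJ : ∀ x ∈ I.cells, σJ x = ρJ x)
    (hL : ∀ x ∈ I.cells, σL x = ρL x) :
    Isomorphic (glue K' H' I) (glue K'' H'' I) :=
  ⟨comparison I K' K'' H'' ρJ σJ ρL σL, comparison I K'' K' H' σJ ρJ σL ρL,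
    h.comparison_isCCHom hI h' hI' hJ hL,
    h'.comparison_isCCHom hI' h hI (fun x hx => (hJ x hx).symm) fun x hx => (hL x hx).symm,
    fun _ hx => h.comparison_comparison hI h' hI' hx,
    fun _ hx => h'.comparison_comparison hI' h hI hx⟩

end Connects

/-! ### Gluing cobordisms -/

namespace Glues

variable {K H J L : CellData V} {R : ℕ}

/-- A cell of the union outside `H` has no vertex in a subcomplex of `H` disjoint from `J`. -/
theorem disjoint_verts (h : Glues K H J R) {L₀ : CellData V} (hL : L₀.cells ⊆ H.cells)
    (hd : Disjoint J.cells L₀.cells) {x : Set V} (hx : x ∈ K.cells) {v : V} (hv : v ∈ x) :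
    v ∉ L₀.verts := fun hvL =>
  Set.disjoint_left.1 hd (h.mem_inter (h.left.isCC.singleton_mem hx hv) (hL hvL)) hvL

theorem collar_eq (h : Glues K H J R) {L₀ : CellData V} (hL : L₀.cells ⊆ H.cells)
    (hd : Disjoint J.cells L₀.cells) : (glue K H J).collar L₀ = H.collar L₀ := by
  ext x
  constructor
  · rintro ⟨hx | hx, ⟨v, hvx, hv⟩, hne⟩
    · exact absurd hv (h.disjoint_verts hL hd hx hvx)
    · exact ⟨hx, ⟨v, hvx, hv⟩, hne⟩
  · rintro ⟨hx, hne⟩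
    exact ⟨Or.inr hx, hne⟩

/-- The midsection depends only on the collar and the ranks of its cells. The collar of `L₀` lies in
`H`, where gluing leaves ranks unchanged. -/
theorem midsection_eq (h : Glues K H J R) {L₀ : CellData V} (hL : L₀.cells ⊆ H.cells)
    (hd : Disjoint J.cells L₀.cells) : (glue K H J).midsection L₀ = H.midsection L₀ := by
  have hc := h.collar_eq hL hd
  have he : (glue K H J).collarEdges L₀ = H.collarEdges L₀ := by
    funext x
    ext e
    simp only [collarEdges, Set.mem_ofPred_eq, hc]
    refine and_congr_right fun heH => ?_
    rw [h.rk_right heH.1]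
  have hr : ∀ m r, (∃ x ∈ H.collar L₀, H.collarEdges L₀ x = m ∧ r + 1 = (glue K H J).rk x) ↔
      ∃ x ∈ H.collar L₀, H.collarEdges L₀ x = m ∧ r + 1 = H.rk x := fun m r =>
    exists_congr fun x => and_congr_right fun hx => by rw [h.rk_right hx.1]
  simp only [midsection, hc, he, hr]

end Glues

/-- Being disjoint from `J`, the complex `L` stays in the boundary, and the conditions along it
concern only collars in `H`. The rest is membership of the union in the class `C^(R+1)`. -/
theorem IsCob.glue_isCob {R : ℕ} {K H J L : CellData V} (hH : IsCob H L) (h : Glues K H J R)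
    (hd : Disjoint J.cells L.cells) :
    IsCob (glue K H J) L := by
  have hLH : L.cells ⊆ H.cells := fun x hx => (hH.sub.1 hx).1
  have hnd : NonDegenerate (glue K H J) L := by
    rintro x (hx | hx) hxL hsub
    · obtain ⟨v, hv⟩ := h.left.isCC.nonempty x hx
      exact h.disjoint_verts hLH hd hx hv (hsub hv)
    · exact hH.nonDegenerate x hx hxL hsub
  have hsub : L.IsSub (glue K H J).boundary := by
    have hmem : L.cells ⊆ (glue K H J).boundary.cells := by
      rw [h.boundary_cells]
      exact fun x hx => Or.inr ⟨hH.sub.1 hx, Set.disjoint_right.1 hd hx⟩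
    refine ⟨hmem, fun x hx => ?_⟩
    rw [boundary_rk (hmem hx), h.rk_right (hLH hx), hH.sub.2 x hx, boundary_rk (hH.sub.1 hx)]
  have hcomp : ∀ L₀ : CellData V, L₀.IsComponent L →
      L₀.cells ⊆ H.cells ∧ Disjoint J.cells L₀.cells := fun L₀ h₀ =>
    ⟨h₀.cells_subset.trans hLH, hd.mono_right h₀.cells_subset⟩
  exact
    { inC := h.Rk_eq ▸ h.inC
      sub := hsub
      inB := by
        have := hH.inB
        rwa [h.right.inC.rank_eq, ← h.Rk_eq] at this
      nonDegenerate := hnd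
      isLocalRel :=
        { relCC :=
            { left := h.isCC
              right := hH.inB.1.isCC
              sub := ⟨fun x hx => (hsub.1 hx).1, fun x hx => by
                rw [hsub.2 x hx, boundary_rk (hsub.1 hx)]⟩ }
          nonDegenerate := hnd
          isLocal := h.isLocal
          inter_connected := fun L₀ h₀ x hx => by
            rw [h.collar_eq (hcomp L₀ h₀).1 (hcomp L₀ h₀).2] at hx
            exact hH.isLocalRel.inter_connected L₀ h₀ x hx
          midsection_cellConnected := fun L₀ h₀ => by
            rw [h.midsection_eq (hcomp L₀ h₀).1 (hcomp L₀ h₀).2]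
            exact hH.isLocalRel.midsection_cellConnected L₀ h₀ } }

end CellData

theorem mainTheorem12 {A B V : Type*} :
    -- the union is an element of `C^(R+1)`, unique up to isomorphism
    (∀ (R : ℕ) (K J : CellData A) (H L : CellData B) (I K' H' : CellData V)
        (ρJ : Set V → Set A) (ρL : Set V → Set B),
      CellData.Connects R K J H L I K' H' ρJ ρL →
      K'.cells ∩ H'.cells = I.cells →
        (CellData.glue K' H' I).InC (R + 1) ∧
        ∀ (K'' H'' : CellData V) (σJ : Set V → Set A) (σL : Set V → Set B),
          CellData.Connects R K J H L I K'' H'' σJ σL →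
          K''.cells ∩ H''.cells = I.cells →
          (∀ x ∈ I.cells, σJ x = ρJ x) → (∀ x ∈ I.cells, σL x = ρL x) →
            CellData.Isomorphic (CellData.glue K' H' I) (CellData.glue K'' H'' I)) ∧
    -- gluing cobordisms along a common boundary component
    (∀ (R : ℕ) (K H J L : CellData V),
      CellData.IsCob K J → CellData.IsCob H L →
      H.boundary.cells = J.cells ∪ L.cells → Disjoint J.cells L.cells →
      K.cells ∩ H.cells = J.cells →
      CellData.Connects R K J H J J K H id id →
        CellData.IsCob (CellData.glue K H J) L) := by
  refine ⟨?_, ?_⟩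
  · intro R K J H L I K' H' ρJ ρL h hI
    exact ⟨(h.glues hI).inC, fun K'' H'' σJ σL h' hI' hJ hL =>
      h.isomorphic_glue hI h' hI' hJ hL⟩
  · intro R K H J L _ hH _ hd hI h
    -- With identity reductions the glued complexes are `K` and `H` themselves, with `I = J`.
    exact hH.glue_isCob (h.glues hI) hd
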